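/- Let $N\ge 1$ be an integer, $2\pi\hbar=1/N$ and $\theta=(\theta_1,\theta_2)\in\mathbb R^2$. On functions $\mathbb C\to\mathbb C$ put $$(U(a)\phi)(z)=e^{(\bar a z-|a|^2/2)/\hbar}\,\phi(z-a)\quad(a\in\mathbb C),\qquad U=U(-i\hbar\pi\sqrt2),\quad V=U(\hbar\pi\sqrt2),\quad X=U^N,\quad Y=V^N,$$ and let $\mathcal H_\hbar(\theta)$ be the space of entire functions $\phi$ with $X\phi=e^{2\pi i\theta_1}\phi$ and $Y\phi=e^{2\pi i\theta_2}\phi$. For $\phi_1,\phi_2\in\mathcal H_\hbar(\theta)$ let $$(\phi_1,\phi_2)_P=\int_D\overline{\phi_1(z)}\,\phi_2(z)\,d\mu_\hbar(z),\qquad d\mu_\hbar(z)=(\pi\hbar)^{-1}e^{-|z|^2/\hbar}\,d^2z,$$ where $D=\{(x-ip)/\sqrt2 : x,p\in[0,1]\}$ and $d^2z$ is Lebesgue measure on the plane. A position representation of a function $\phi$ on $\mathbb C$ is a complex Radon measure $\Psi(x)\,dx$ on $\mathbb R$ (for instance a comb of point masses) such that for every $z\in\mathbb C$ $$\int_{\mathbb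 R}B(z,x)\,\Psi(x)\,dx=\phi(z),\qquad B(z,x)=(\pi\hbar)^{-1/4}\,e^{(\sqrt2\,xz-x^2/2-z^2/2)/\hbar},$$ with absolute convergence. Let $$K(x,y)=g\Big(\frac{x-y}{2\hbar}\Big),\qquad g(r)=\frac1{2\pi\hbar}\,e^{-\hbar r^2+ir}\,\frac{\sin r}{r}\quad\Big(\frac{\sin 0}{0}:=1\Big),\qquad (K\Psi)(x)=\int_{\mathbb R}K(x,y)\Psi(y)\,dy .$$ Then every $\phi\in\mathcal H_\hbar(\theta)$ has a position representation, and for all $\phi_1,\phi_2\in\mathcal H_\hbar(\theta)$ and all position representations $\Psi_1$ of $\phi_1$ and $\Psi_2$ of $\phi_2$, $$(\phi_1,\phi_2)_P=\int_0^1\overline{\Psi_1(x)}\,(K\Psi_2)(x)\,dx ,$$ where all integrals converge absolutely and $\int_0^1$ is the integral over $[0,1)$ against the measure $\overline{\Psi_1(x)}\,dx$. -/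

import Mathlib

open scoped ComplexConjugate

noncomputable section

namespace QuantumTorus

/-! ### Bargmann space, translations, and the fibers of the theta-torus -/

/-- The measure `dμ_ħ(z) = (π ħ)⁻¹ exp (-|z|² / ħ) d²z` on the complex plane
(`d²z` is Lebesgue area measure). -/
def bargmannMeasure (ħ : ℝ) : MeasureTheory.Measure ℂ :=
  MeasureTheory.volume.withDensity
    (fun z => ENNReal.ofReal ((Real.pi * ħ)⁻¹ * Real.exp (-‖z‖ ^ 2 / ħ)))

/-- The phase-space translation
`(U(a) φ)(z) = exp ((conj a * z - |a|² / 2) / ħ) * φ (z - a)`, acting on functions on `ℂ`. -/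
def translation (ħ : ℝ) (a : ℂ) : Module.End ℂ (ℂ → ℂ) where
  toFun φ := fun z => Complex.exp ((conj a * z - (‖a‖ : ℂ) ^ 2 / 2) / ħ) * φ (z - a)
  map_add' φ ψ := by
    funext z
    simp only [Pi.add_apply]
    ring
  map_smul' c φ := by
    funext z
    simp only [Pi.smul_apply, smul_eq_mul, RingHom.id_apply]
    ring

/-- The generator `U = U(-i ħ π √2)` of the quantum torus algebra. -/
def opU (ħ : ℝ) : Module.End ℂ (ℂ → ℂ) :=
  translation ħ (-(Complex.I * ħ * Real.pi * (Real.sqrt 2 : ℝ)))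

/-- The generator `V = U(ħ π √2)` of the quantum torus algebra. -/
def opV (ħ : ℝ) : Module.End ℂ (ℂ → ℂ) :=
  translation ħ ((ħ : ℂ) * Real.pi * (Real.sqrt 2 : ℝ))

/-- The central element `X = U ^ N`. -/
def opX (ħ : ℝ) (N : ℕ) : Module.End ℂ (ℂ → ℂ) := opU ħ ^ N

/-- The central element `Y = V ^ N`. -/
def opY (ħ : ℝ) (N : ℕ) : Module.End ℂ (ℂ → ℂ) := opV ħ ^ N

/-- The space of entire functions. -/
def entireFunctions : Submodule ℂ (ℂ → ℂ) where
  carrier := {φ | Differentiable ℂ φ}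
  add_mem' hφ hψ := hφ.add hψ
  zero_mem' := differentiable_const (0 : ℂ)
  smul_mem' c _ hφ := hφ.const_smul c

/-- The fiber over `θ = (θ₁, θ₂)`: the entire functions `φ` with
`X φ = exp (2 π i θ₁) φ` and `Y φ = exp (2 π i θ₂) φ`. -/
def fiber (ħ : ℝ) (N : ℕ) (θ : ℝ × ℝ) : Submodule ℂ (ℂ → ℂ) :=
  entireFunctions ⊓
    (opX ħ N).eigenspace (Complex.exp (2 * Real.pi * Complex.I * θ.1)) ⊓
    (opY ħ N).eigenspace (Complex.exp (2 * Real.pi * Complex.I * θ.2))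

/-- The fundamental domain `D = [0,1] × [0,1]` in the phase-space coordinates `(x, p)` given by
`z = (x - i p) / √2`. -/
def fundamentalDomain : Set ℂ :=
  {z | Real.sqrt 2 * z.re ∈ Set.Icc (0 : ℝ) 1 ∧ -(Real.sqrt 2 * z.im) ∈ Set.Icc (0 : ℝ) 1}

/-- The inner product on a fiber: the Bargmann inner product restricted to the fundamental
domain, conjugate-linear in the first argument. -/
def fiberInner (ħ : ℝ) (φ₁ φ₂ : ℂ → ℂ) : ℂ :=
  ∫ z in fundamentalDomain, conj (φ₁ z) * φ₂ z ∂(bargmannMeasure ħ)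

/-! ### Position representation -/

/-- A generalized position wave function `Ψ(x) dx`: a complex Radon measure on the line, in polar
form `phase · mass` with `mass = |Ψ|` a locally finite positive measure and `|phase| = 1`.
An ordinary locally integrable wave function `ψ` has `mass = |ψ| dx`; the comb `∑ₖ cₖ δ_{xₖ}` has
`mass = ∑ₖ |cₖ| δ_{xₖ}`. -/
structure PositionWave where
  mass : MeasureTheory.Measure ℝ
  locallyFinite : MeasureTheory.IsLocallyFiniteMeasure mass
  phase : ℝ → ℂ
  measurable_phase : Measurable phase
  norm_phase : ∀ x, ‖phase x‖ = 1

/-- The kernel `B(z,x) = (π ħ)^(-1/4) exp ((√2 x z - x²/2 - z²/2) / ħ)` of the Bargmann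
transformation. -/
def bargmannKernel (ħ : ℝ) (z : ℂ) (x : ℝ) : ℂ :=
  (((Real.pi * ħ) ^ (-(1 / 4 : ℝ)) : ℝ) : ℂ) *
    Complex.exp (((Real.sqrt 2 : ℝ) * x * z - (x : ℂ) ^ 2 / 2 - z ^ 2 / 2) / ħ)

/-- `Ψ` is a position representation of the function `φ`: for every `z` the Bargmann
transformation `∫ B(z,x) Ψ(x) dx` converges absolutely and equals `φ z`. -/
def PositionWave.Represents (ħ : ℝ) (Ψ : PositionWave) (φ : ℂ → ℂ) : Prop :=
  ∀ z : ℂ,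
    MeasureTheory.Integrable (fun x : ℝ => bargmannKernel ħ z x * Ψ.phase x) Ψ.mass ∧
    ∫ x : ℝ, bargmannKernel ħ z x * Ψ.phase x ∂Ψ.mass = φ z

/-- `g(r) = (2 π ħ)⁻¹ exp (-ħ r² + i r) (sin r / r)`, where `sin r / r` is `1` at `r = 0`. -/
def gFun (ħ : ℝ) (r : ℝ) : ℂ :=
  ((2 * Real.pi * ħ)⁻¹ : ℝ) * Complex.exp (-(ħ : ℂ) * (r : ℂ) ^ 2 + Complex.I * r) *
    (Real.sinc r : ℝ)

/-- `K(x,y) = g((x - y) / (2 ħ))`. -/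
def kernelK (ħ : ℝ) (x y : ℝ) : ℂ := gFun ħ ((x - y) / (2 * ħ))

/-- `(K Ψ)(x) = ∫ K(x,y) Ψ(y) dy`, the integral being over the whole line. -/
def applyK (ħ : ℝ) (Ψ : PositionWave) (x : ℝ) : ℂ :=
  ∫ y : ℝ, kernelK ħ x y * Ψ.phase y ∂Ψ.mass

/-- `∫₀¹ conj (Ψ x) f(x) dx`. The fundamental domain of the line is taken half open, so that a
point mass on its boundary is counted once. -/
def unitPairing (Ψ : PositionWave) (f : ℝ → ℂ) : ℂ :=
  ∫ x in Set.Ico (0 : ℝ) 1, conj (Ψ.phase x) * f x ∂Ψ.mass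

end QuantumTorus

end

/-!
The centre of the quantum torus is generated by the translations by the two periods of the torus,
`X = U(-i/√2)` and `Y = U(1/√2)` (`opX_eq`, `opY_eq`). On the Bargmann kernel they act in the
position variable: `X` multiplies `B(z, x)` by `exp (i x / ħ) = exp (2 π i N x)`, and `Y` replaces
`x` by `x + 1` (`translation_bargmannKernel_im`, `translation_bargmannKernel_re`).

Existence. For `φ` in the fiber, `exp (z² / 2ħ) φ(z)` times a suitable character is entire and
periodic in the imaginary direction, so it is the sum of an absolutely convergent Fourier series
(`exists_hasSum_exp_of_periodic`). Its terms are the kernels `B(z, x_j)` at the lattice points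
`x_j = (j + θ₁) / N`, and the coefficients form the comb (`exists_represents`).

Rigidity. Restricted to imaginary `z`, the Bargmann transform is a Fourier transform, which is
injective on complex measures (`ae_eq_zero_of_fourier_eq_zero`). Hence the eigenvalue equation for
`X` confines any position representation to the lattice points
(`PositionWave.Represents.ae_mem_range`), and the one for `Y` makes its coefficients `c_j`
quasi-periodic with period `N` (`PositionWave.Represents.combCoeff_sub`).

Both sides of the identity then equal `N ∑ conj (c₁ j) * c₂ j`, the sum over the `N` lattice points
in `[0, 1)`.
* The kernel `K` restricted to the lattice is `N` times the identity, because `sin r / r` vanishes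
  at the nonzero multiples of `π` (`kernelK_latticePoint`,
  `PositionWave.Represents.unitPairing_eq`).
* In the coordinates `z = (x - i p) / √2` the weighted product `conj φ₁ * φ₂` is a double series of
  Gaussians in `x` times characters `exp (2 π i (j - k) p)`. Integration over `p` keeps the diagonal
  (`setIntegral_pairTerm`), and by periodicity of the coefficients the remaining integrals over
  `x ∈ [0, 1]` unfold to Gaussian integrals over the line (`tsum_mul_integral_positionGaussian`,
  `PositionWave.Represents.fiberInner_eq`).
-/

namespace QuantumTorus

open MeasureTheory

/-! ### Fourier analysis -/

/-- A real integrable density with vanishing Fourier transform is zero: the positive and negative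
parts define finite measures with equal characteristic functions. -/
theorem ae_eq_zero_of_fourier_eq_zero_real {μ : Measure ℝ} {h : ℝ → ℝ} (hh : Integrable h μ)
    (H : ∀ t : ℝ, ∫ x : ℝ, Complex.exp (t * x * Complex.I) * h x ∂μ = 0) : h =ᵐ[μ] 0 := by
  have hneg : Integrable (fun x => -h x) μ := hh.neg
  have key : ∀ (f : ℝ → ℝ), Integrable f μ → ∀ t : ℝ,
      Integrable (fun x : ℝ => Complex.exp (t * x * Complex.I) * ((max (f x) 0 : ℝ) : ℂ)) μ ∧
      charFun (μ.withDensity fun x => ENNReal.ofReal (f x)) t =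
        ∫ x : ℝ, Complex.exp (t * x * Complex.I) * ((max (f x) 0 : ℝ) : ℂ) ∂μ := by
    intro f hf t
    constructor
    · refine (hf.pos_part.ofReal (𝕜 := ℂ)).bdd_mul (c := 1) (by fun_prop) ?_
      refine Filter.Eventually.of_forall fun x => le_of_eq ?_
      rw [← Complex.ofReal_mul, Complex.norm_exp_ofReal_mul_I]
    · rw [charFun_apply_real,
        integral_withDensity_eq_integral_toReal_smul₀ hf.aemeasurable.ennreal_ofReal
          (Filter.Eventually.of_forall fun _ => ENNReal.ofReal_lt_top)]
      refine integral_congr_ae (Filter.Eventually.of_forall fun x => ?_)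
      simp only [ENNReal.toReal_ofReal', Complex.real_smul]
      ring
  have hfin₁ : IsFiniteMeasure (μ.withDensity fun x => ENNReal.ofReal (h x)) :=
    isFiniteMeasure_withDensity_ofReal hh.2
  have hfin₂ : IsFiniteMeasure (μ.withDensity fun x => ENNReal.ofReal (-h x)) :=
    isFiniteMeasure_withDensity_ofReal hneg.2
  have heq : (μ.withDensity fun x => ENNReal.ofReal (h x)) =
      μ.withDensity fun x => ENNReal.ofReal (-h x) := by
    refine Measure.ext_of_charFun (funext fun t => ?_)
    obtain ⟨h1, e1⟩ := key h hh t
    obtain ⟨h2, e2⟩ := key _ hneg t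
    rw [e1, e2, ← sub_eq_zero, ← integral_sub h1 h2, ← H t]
    refine integral_congr_ae (Filter.Eventually.of_forall fun x => ?_)
    simp only [← mul_sub, ← Complex.ofReal_sub]
    rw [max_zero_sub_eq_self]
  rw [withDensity_eq_iff hh.aemeasurable.ennreal_ofReal hneg.aemeasurable.ennreal_ofReal
    (by
      have := hh.lintegral_lt_top
      exact this.ne)] at heq
  filter_upwards [heq] with x hx
  rcases le_total (h x) 0 with h0 | h0
  · rw [ENNReal.ofReal_of_nonpos h0, eq_comm, ENNReal.ofReal_eq_zero] at hx
    simp only [Pi.zero_apply]; linarith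
  · rw [ENNReal.ofReal_of_nonpos (by linarith : -h x ≤ 0), ENNReal.ofReal_eq_zero] at hx
    simp only [Pi.zero_apply]; linarith

/-- Injectivity of the Fourier transform on complex measures, written as integrable densities. -/
theorem ae_eq_zero_of_fourier_eq_zero {μ : Measure ℝ} {h : ℝ → ℂ} (hh : Integrable h μ)
    (H : ∀ t : ℝ, ∫ x : ℝ, Complex.exp (t * x * Complex.I) * h x ∂μ = 0) : h =ᵐ[μ] 0 := by
  have hexp : ∀ t : ℝ, Integrable (fun x : ℝ => Complex.exp (t * x * Complex.I) * h x) μ := by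
    intro t
    refine hh.bdd_mul (c := 1) (by fun_prop) (Filter.Eventually.of_forall fun x => le_of_eq ?_)
    rw [← Complex.ofReal_mul, Complex.norm_exp_ofReal_mul_I]
  have hconjexp : ∀ t : ℝ, (fun x : ℝ => Complex.exp (t * x * Complex.I) * conj (h x)) =
      fun x : ℝ => conj (Complex.exp ((-t : ℝ) * x * Complex.I) * h x) := by
    intro t
    funext x
    rw [map_mul, ← Complex.exp_conj]
    simp
  have Hc : ∀ t : ℝ, ∫ x : ℝ, Complex.exp (t * x * Complex.I) * conj (h x) ∂μ = 0 := by
    intro t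
    rw [hconjexp, integral_conj, H, map_zero]
  have hexpc : ∀ t : ℝ,
      Integrable (fun x : ℝ => Complex.exp (t * x * Complex.I) * conj (h x)) μ := by
    intro t
    rw [hconjexp]
    exact (Complex.conjCLE.toContinuousLinearMap.integrable_comp (hexp (-t)))
  have hre : (fun x => (h x).re) =ᵐ[μ] 0 := by
    refine ae_eq_zero_of_fourier_eq_zero_real hh.re fun t => ?_
    have e : (fun x : ℝ => Complex.exp (t * x * Complex.I) * ((h x).re : ℂ)) = fun x : ℝ =>
        (1 / 2 : ℂ) * (Complex.exp (t * x * Complex.I) * h x +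
          Complex.exp (t * x * Complex.I) * conj (h x)) := by
      funext x
      rw [Complex.re_eq_add_conj]
      ring
    rw [e, integral_const_mul, integral_add (hexp t) (hexpc t), H, Hc]
    simp
  have him : (fun x => (h x).im) =ᵐ[μ] 0 := by
    refine ae_eq_zero_of_fourier_eq_zero_real hh.im fun t => ?_
    have e : (fun x : ℝ => Complex.exp (t * x * Complex.I) * ((h x).im : ℂ)) = fun x : ℝ =>
        (1 / (2 * Complex.I) : ℂ) * (Complex.exp (t * x * Complex.I) * h x -
          Complex.exp (t * x * Complex.I) * conj (h x)) := by
      funext x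
      rw [Complex.im_eq_sub_conj]
      ring
    rw [e, integral_const_mul, integral_sub (hexp t) (hexpc t), H, Hc]
    simp
  filter_upwards [hre, him] with x h1 h2
  exact Complex.ext h1 h2

/-- A summable trigonometric series vanishing identically has zero coefficients. -/
theorem eq_zero_of_forall_tsum_exp_eq_zero {d : ℤ → ℂ} (hd : Summable fun j => ‖d j‖)
    (H : ∀ t : ℝ, ∑' j : ℤ, Complex.exp (t * j * Complex.I) * d j = 0) (j : ℤ) : d j = 0 := by
  have hinj : Function.Injective (fun k : ℤ => (k : ℝ)) := Int.cast_injective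
  have hemb : MeasurableEmbedding (fun k : ℤ => (k : ℝ)) :=
    Int.isClosedEmbedding_coe_real.measurableEmbedding
  have hext : ∀ k : ℤ, Function.extend (fun k : ℤ => (k : ℝ)) d 0 (k : ℝ) = d k :=
    fun k => hinj.extend_apply d 0 k
  have hint : Integrable d (Measure.count : Measure ℤ) := by
    rwa [integrable_count_iff]
  have := ae_eq_zero_of_fourier_eq_zero
    (μ := (Measure.count : Measure ℤ).map (fun k : ℤ => (k : ℝ)))
    (h := Function.extend (fun k : ℤ => (k : ℝ)) d 0)
    (by
      rw [hemb.integrable_map_iff]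
      refine hint.congr (Filter.Eventually.of_forall fun k => ?_)
      simp [hext])
    (by
      intro t
      rw [hemb.integral_map]
      simp only [hext]
      rw [integral_countable, ← H t]
      · simp
      · refine hint.bdd_mul (c := 1) (by fun_prop) (Filter.Eventually.of_forall fun k => ?_)
        rw [← Complex.ofReal_mul, Complex.norm_exp_ofReal_mul_I])
  rw [Filter.EventuallyEq, hemb.ae_map_iff, Measure.ae_count_iff] at this
  simpa [hext] using this j

/-- The Fourier coefficient of a one-periodic entire function is the same on all horizontal
lines. -/
theorem integral_horizontal_eq {G : ℂ → ℂ} (hG : Differentiable ℂ G) (hp : ∀ w, G (w + 1) = G w)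
    (y : ℝ) : ∫ t in (0 : ℝ)..1, G (t + y * Complex.I) = ∫ t in (0 : ℝ)..1, G t := by
  have h := Complex.integral_boundary_rect_eq_zero_of_differentiableOn G 0 (1 + y * Complex.I)
    hG.differentiableOn
  have hs : ∀ s : ℝ, G (1 + s * Complex.I) = G (s * Complex.I) := fun s => by
    rw [add_comm, hp]
  simp only [Complex.zero_re, Complex.zero_im, Complex.add_re, Complex.one_re, Complex.mul_re,
    Complex.ofReal_re, Complex.I_re, mul_zero, Complex.ofReal_im, Complex.I_im, mul_one, sub_self,
    add_zero, Complex.add_im, Complex.one_im, Complex.mul_im, zero_add, Complex.ofReal_zero,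
    zero_mul, Complex.ofReal_one, hs] at h
  linear_combination -h

/-- Laurent expansion in the variable `exp (2 π i w)`: an entire function of period one is the sum
of an absolutely convergent Fourier series. The coefficients, computed on the lines at height
`y ± 1`, decay geometrically at height `y`. -/
theorem exists_hasSum_exp_of_periodic {F : ℂ → ℂ} (hF : Differentiable ℂ F)
    (hp : ∀ w, F (w + 1) = F w) :
    ∃ d : ℤ → ℂ, ∀ w : ℂ,
      HasSum (fun j : ℤ => d j * Complex.exp (2 * Real.pi * Complex.I * j * w)) (F w) := by
  set e : ℤ → ℂ → ℂ := fun j w => Complex.exp (2 * Real.pi * Complex.I * j * w) with he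
  have hediff : ∀ j, Differentiable ℂ (e j) := fun j => by
    simp only [he]; fun_prop
  have henorm : ∀ (j : ℤ) (t y : ℝ),
      ‖e j (t + y * Complex.I)‖ = Real.exp (-2 * Real.pi * j * y) := by
    intro j t y
    simp only [he, Complex.norm_exp]
    congr 1
    simp
  set d : ℤ → ℂ := fun j => ∫ t in (0 : ℝ)..1, F t * e (-j) t with hd
  have hdy : ∀ (j : ℤ) (y : ℝ),
      ∫ t in (0 : ℝ)..1, F (t + y * Complex.I) * e (-j) (t + y * Complex.I) = d j := by
    intro j y
    refine integral_horizontal_eq (G := fun w => F w * e (-j) w) (hF.mul (hediff _)) (fun w => ?_) y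
    simp only [hp, he]
    congr 1
    rw [Complex.exp_eq_exp_iff_exists_int]
    refine ⟨-j, ?_⟩
    push_cast
    ring
  have hbound : ∀ y : ℝ, ∃ M : ℝ, ∀ j : ℤ, ‖d j‖ ≤ M * Real.exp (2 * Real.pi * j * y) := by
    intro y
    obtain ⟨M, hM⟩ := isCompact_Icc.exists_bound_of_continuousOn (s := Set.Icc (0 : ℝ) 1)
      (f := fun t : ℝ => F (t + y * Complex.I))
      (hF.continuous.comp (by fun_prop)).continuousOn
    refine ⟨M, fun j => ?_⟩
    rw [← hdy j y]
    refine (intervalIntegral.norm_integral_le_of_norm_le_const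
      (C := M * Real.exp (2 * Real.pi * j * y)) fun t ht => ?_).trans (by simp)
    rw [Set.uIoc_of_le zero_le_one] at ht
    rw [norm_mul, henorm]
    refine mul_le_mul (hM t ⟨ht.1.le, ht.2⟩) (le_of_eq ?_) (by positivity)
      ((norm_nonneg _).trans (hM t ⟨ht.1.le, ht.2⟩))
    congr 1
    push_cast
    ring
  refine ⟨d, fun w => ?_⟩
  obtain ⟨M₁, hM₁⟩ := hbound (w.im - 1)
  obtain ⟨M₂, hM₂⟩ := hbound (w.im + 1)
  set q : ℝ := Real.exp (-2 * Real.pi) with hq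
  have hq1 : q < 1 := by
    rw [hq, Real.exp_lt_one_iff]; nlinarith [Real.pi_pos]
  have hsum : Summable fun j : ℤ => d j * (Real.exp (-2 * Real.pi * j * w.im) : ℂ) := by
    have hgeo : Summable fun n : ℕ => q ^ n := summable_geometric_of_lt_one (Real.exp_nonneg _) hq1
    have hqn : ∀ n : ℕ, q ^ n = Real.exp (-2 * Real.pi * n) := fun n => by
      rw [hq, ← Real.exp_nat_mul]; congr 1; ring
    refine Summable.of_nat_of_neg (Summable.of_norm_bounded (hgeo.mul_left M₁) fun n => ?_)
      (Summable.of_norm_bounded (hgeo.mul_left M₂) fun n => ?_)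
    · rw [norm_mul, Complex.norm_real, Real.norm_of_nonneg (Real.exp_nonneg _)]
      refine (mul_le_mul_of_nonneg_right (hM₁ n) (Real.exp_nonneg _)).trans (le_of_eq ?_)
      rw [hqn, mul_assoc, ← Real.exp_add]
      congr 2
      push_cast
      ring
    · rw [norm_mul, Complex.norm_real, Real.norm_of_nonneg (Real.exp_nonneg _)]
      refine (mul_le_mul_of_nonneg_right (hM₂ _) (Real.exp_nonneg _)).trans (le_of_eq ?_)
      rw [hqn, mul_assoc, ← Real.exp_add]
      congr 2
      push_cast
      ring
  have : Fact ((0 : ℝ) < 1) := ⟨one_pos⟩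
  have hper : Function.Periodic (fun t : ℝ => F (t + w.im * Complex.I)) 1 := fun t => by
    refine Eq.trans ?_ (hp (t + w.im * Complex.I))
    change F ((t + 1 : ℝ) + w.im * Complex.I) = _
    congr 1
    push_cast
    ring
  let f : C(AddCircle (1 : ℝ), ℂ) := ⟨hper.lift, by
    refine continuous_coinduced_dom.mpr ?_
    exact hF.continuous.comp (by fun_prop)⟩
  have hf : ∀ t : ℝ, f (t : AddCircle (1 : ℝ)) = F (t + w.im * Complex.I) := fun t => rfl
  have hcoeff : ∀ j, fourierCoeff f j = d j * (Real.exp (-2 * Real.pi * j * w.im) : ℂ) := by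
    intro j
    rw [fourierCoeff_eq_intervalIntegral _ j 0, ← hdy j w.im, ← intervalIntegral.integral_mul_const]
    simp only [zero_add, div_one, one_smul]
    refine intervalIntegral.integral_congr fun t _ => ?_
    simp only [hf, fourier_coe_apply, he, smul_eq_mul]
    rw [mul_comm (Complex.exp _), Complex.ofReal_exp,
      mul_assoc (F _) (Complex.exp _) (Complex.exp _),
      ← Complex.exp_add]
    congr 2
    push_cast
    linear_combination (2 * Real.pi * j * w.im : ℂ) * Complex.I_sq
  have := has_pointwise_sum_fourier_series_of_summable (f := f)
    (by simpa only [funext hcoeff] using hsum) (w.re : AddCircle (1 : ℝ))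
  rw [hf, Complex.re_add_im] at this
  convert this using 2 with j
  rw [hcoeff, fourier_coe_apply, smul_eq_mul, Complex.ofReal_exp,
    mul_assoc (d j) (Complex.exp _) (Complex.exp _), ← Complex.exp_add]
  congr 2
  conv_lhs => rw [← Complex.re_add_im w]
  push_cast
  linear_combination (2 * Real.pi * j * w.im : ℂ) * Complex.I_sq

/-! ### Translations and the Bargmann kernel -/

theorem translation_apply (ħ : ℝ) (a : ℂ) (φ : ℂ → ℂ) (z : ℂ) :
    translation ħ a φ z =
      Complex.exp ((conj a * z - (‖a‖ : ℂ) ^ 2 / 2) / ħ) * φ (z - a) := rfl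

theorem translation_pow (ħ : ℝ) (a : ℂ) (n : ℕ) :
    translation ħ a ^ n = translation ħ (n * a) := by
  induction n with
  | zero =>
    ext φ z
    simp [translation_apply]
  | succ n ih =>
    ext φ z
    rw [pow_succ', Module.End.mul_apply, translation_apply, ih, translation_apply,
      translation_apply, ← mul_assoc, ← Complex.exp_add]
    simp only [← Complex.conj_mul', map_mul, map_natCast]
    push_cast
    congr 2
    · ring
    · ring

theorem sqrt_two_sq : ((Real.sqrt 2 : ℝ) : ℂ) ^ 2 = 2 := by
  rw [← Complex.ofReal_pow, Real.sq_sqrt zero_le_two, Complex.ofReal_ofNat]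

section

variable {N : ℕ} {ħ : ℝ}

theorem planck_pos (hN : 1 ≤ N) (hħ : 2 * Real.pi * ħ = 1 / (N : ℝ)) : 0 < ħ := by
  have hN' : (0 : ℝ) < N := by exact_mod_cast hN
  have : 0 < 2 * Real.pi * ħ := by rw [hħ]; positivity
  exact pos_of_mul_pos_right this (by positivity)

theorem planck_mul (hN : 1 ≤ N) (hħ : 2 * Real.pi * ħ = 1 / (N : ℝ)) :
    2 * Real.pi * ħ * N = 1 := by
  have hN' : (0 : ℝ) < N := by exact_mod_cast hN
  rw [hħ]; field_simp

theorem planck_mul_complex (hN : 1 ≤ N) (hħ : 2 * Real.pi * ħ = 1 / (N : ℝ)) :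
    2 * Real.pi * ħ * N = (1 : ℂ) := by
  exact_mod_cast congrArg (fun x : ℝ => (x : ℂ)) (planck_mul hN hħ)

/-- The generators of the centre are the translations by the two periods of the torus. -/
theorem opX_eq (hN : 1 ≤ N) (hħ : 2 * Real.pi * ħ = 1 / (N : ℝ)) :
    opX ħ N = translation ħ (-(Complex.I * ((Real.sqrt 2 : ℝ) / 2))) := by
  rw [opX, opU, translation_pow]
  congr 1
  linear_combination (-(Complex.I * (Real.sqrt 2 : ℝ) / 2)) * planck_mul_complex hN hħ

theorem opY_eq (hN : 1 ≤ N) (hħ : 2 * Real.pi * ħ = 1 / (N : ℝ)) :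
    opY ħ N = translation ħ ((Real.sqrt 2 : ℝ) / 2) := by
  rw [opY, opV, translation_pow]
  congr 1
  linear_combination ((Real.sqrt 2 : ℝ) / 2 : ℂ) * planck_mul_complex hN hħ

theorem mem_fiber_iff (hN : 1 ≤ N) (hħ : 2 * Real.pi * ħ = 1 / (N : ℝ)) {θ : ℝ × ℝ}
    {φ : ℂ → ℂ} : φ ∈ fiber ħ N θ ↔ Differentiable ℂ φ ∧
      (∀ z, translation ħ (-(Complex.I * ((Real.sqrt 2 : ℝ) / 2))) φ z =
        Complex.exp (2 * Real.pi * Complex.I * θ.1) * φ z) ∧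
      (∀ z, translation ħ ((Real.sqrt 2 : ℝ) / 2) φ z =
        Complex.exp (2 * Real.pi * Complex.I * θ.2) * φ z) := by
  rw [fiber, Submodule.mem_inf, Submodule.mem_inf, Module.End.mem_eigenspace_iff,
    Module.End.mem_eigenspace_iff, opX_eq hN hħ, opY_eq hN hħ, and_assoc, funext_iff, funext_iff]
  rfl

/-- In the position variable, the translation by the imaginary period is a multiplication. -/
theorem translation_bargmannKernel_im (ħ : ℝ) (x : ℝ) (z : ℂ) :
    translation ħ (-(Complex.I * ((Real.sqrt 2 : ℝ) / 2))) (fun w => bargmannKernel ħ w x) z =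
      Complex.exp (Complex.I * x / ħ) * bargmannKernel ħ z x := by
  rw [translation_apply, ← Complex.conj_mul']
  simp only [bargmannKernel, map_neg, map_mul, map_div₀, Complex.conj_I, Complex.conj_ofReal,
    map_ofNat]
  rw [mul_left_comm, mul_left_comm (Complex.exp (Complex.I * x / ħ)), ← Complex.exp_add,
    ← Complex.exp_add, ← add_div, ← add_div]
  congr 3
  linear_combination (Complex.I * x / 2) * sqrt_two_sq

/-- In the position variable, the translation by the real period is the shift by one. -/
theorem translation_bargmannKernel_re (ħ : ℝ) (x : ℝ) (z : ℂ) :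
    translation ħ ((Real.sqrt 2 : ℝ) / 2) (fun w => bargmannKernel ħ w x) z =
      bargmannKernel ħ z (x + 1) := by
  rw [translation_apply, ← Complex.conj_mul']
  simp only [bargmannKernel, map_div₀, Complex.conj_ofReal, map_ofNat]
  rw [mul_left_comm, ← Complex.exp_add, ← add_div]
  congr 3
  push_cast
  linear_combination (-(x : ℂ) / 2 - 1 / 4) * sqrt_two_sq

theorem translation_integral {α : Type*} [MeasurableSpace α] (a : ℂ) (μ : Measure α)
    (k : ℂ → α → ℂ) (p : α → ℂ) (z : ℂ) :
    translation ħ a (fun w => ∫ x, k w x * p x ∂μ) z =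
      ∫ x, translation ħ a (fun w => k w x) z * p x ∂μ := by
  simp only [translation_apply, mul_assoc]
  rw [integral_const_mul]

/-- At `z = i t ħ / √2` the kernel `B(z, ·)` is, up to a nonzero constant, a Gaussian times the
character `x ↦ exp (i t x)`. -/
theorem exists_bargmannKernel_eq (hħ₀ : 0 < ħ) (t : ℝ) : ∃ (z C : ℂ), C ≠ 0 ∧ ∀ x : ℝ,
    bargmannKernel ħ z x =
      C * (Complex.exp (t * x * Complex.I) * (Real.exp (-(x ^ 2 / (2 * ħ))) : ℂ)) := by
  have hc : (ħ : ℂ) ≠ 0 := by exact_mod_cast hħ₀.ne'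
  refine ⟨Complex.I * t * ħ * ((Real.sqrt 2 : ℝ) / 2),
    (((Real.pi * ħ) ^ (-(1 / 4 : ℝ)) : ℝ) : ℂ) *
      Complex.exp (-(Complex.I * t * ħ * ((Real.sqrt 2 : ℝ) / 2)) ^ 2 / 2 / ħ), ?_, fun x => ?_⟩
  · refine mul_ne_zero ?_ (Complex.exp_ne_zero _)
    exact_mod_cast (Real.rpow_pos_of_pos (by positivity) _).ne'
  · rw [bargmannKernel, Complex.ofReal_exp, ← Complex.exp_add, mul_assoc _ (Complex.exp _),
      ← Complex.exp_add]
    congr 2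
    push_cast
    field_simp
    linear_combination (4 * Complex.I * x * t * ħ) * sqrt_two_sq

end

/-! ### Combs and the existence of a position representation -/

/-- The points `x_j = (j + α) / N` of the line at which `exp (2 π i N x) = exp (2 π i α)`. -/
noncomputable def latticePoint (N : ℕ) (α : ℝ) (j : ℤ) : ℝ := (j + α) / N

section

variable {N : ℕ}

theorem mul_latticePoint (hN : 1 ≤ N) (α : ℝ) (j : ℤ) :
    (N : ℝ) * latticePoint N α j = j + α := by
  have hN' : (N : ℝ) ≠ 0 := by positivity
  rw [latticePoint]
  field_simp

theorem latticePoint_of_mul_eq (hN : 1 ≤ N) {α x : ℝ} {j : ℤ} (h : (N : ℝ) * x = j + α) :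
    latticePoint N α j = x := by
  have hN' : (N : ℝ) ≠ 0 := by positivity
  rw [latticePoint, ← h]
  field_simp

theorem latticePoint_injective (hN : 1 ≤ N) (α : ℝ) :
    Function.Injective (latticePoint N α) := fun i j h => by
  have := congrArg (fun x => (N : ℝ) * x) h
  simp only [mul_latticePoint hN] at this
  exact_mod_cast add_right_cancel this

theorem latticePoint_add_mul (hN : 1 ≤ N) (α : ℝ) (j n : ℤ) :
    latticePoint N α (j + n * N) = latticePoint N α j + n := by
  have hN' : (N : ℝ) ≠ 0 := by positivity
  rw [latticePoint, latticePoint]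
  push_cast
  field_simp
  ring

theorem finite_preimage_latticePoint (hN : 1 ≤ N) (α a b : ℝ) :
    {j : ℤ | latticePoint N α j ∈ Set.Icc a b}.Finite := by
  refine (Set.finite_Icc ⌊(N : ℝ) * a - α⌋ ⌈(N : ℝ) * b - α⌉).subset fun j hj => ?_
  have hN' : (0 : ℝ) ≤ N := by positivity
  have h1 := mul_le_mul_of_nonneg_left hj.1 hN'
  have h2 := mul_le_mul_of_nonneg_left hj.2 hN'
  rw [mul_latticePoint hN] at h1 h2
  constructor
  · have : (⌊(N : ℝ) * a - α⌋ : ℝ) ≤ j := (Int.floor_le _).trans (by linarith)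
    exact_mod_cast this
  · have : (j : ℝ) ≤ ⌈(N : ℝ) * b - α⌉ := le_trans (by linarith) (Int.le_ceil _)
    exact_mod_cast this

/-- The comb `∑ j, c j δ_{x_j}` is a position wave. -/
theorem exists_comb (hN : 1 ≤ N) (α : ℝ) (c : ℤ → ℂ) :
    ∃ Ψ : PositionWave, ∀ k : ℝ → ℂ, Summable (fun j => ‖c j * k (latticePoint N α j)‖) →
      Integrable (fun x => k x * Ψ.phase x) Ψ.mass ∧
      ∫ x, k x * Ψ.phase x ∂Ψ.mass = ∑' j, c j * k (latticePoint N α j) := by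
  obtain ⟨p, hp, hpc⟩ : ∃ p : ℤ → ℂ, (∀ j, ‖p j‖ = 1) ∧ ∀ j, (‖c j‖ : ℂ) * p j = c j := by
    have h : ∀ w : ℂ, ∃ u : ℂ, ‖u‖ = 1 ∧ (‖w‖ : ℂ) * u = w := fun w =>
      ⟨Complex.exp (w.arg * Complex.I), Complex.norm_exp_ofReal_mul_I _,
        Complex.norm_mul_exp_arg_mul_I w⟩
    choose u hu using h
    exact ⟨fun j => u (c j), fun j => (hu _).1, fun j => (hu _).2⟩
  have hmeas : Measurable fun x : ℝ => p (round ((N : ℝ) * x - α)) := by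
    have hr : Measurable fun x : ℝ => round ((N : ℝ) * x - α) := by
      simp only [round_eq]
      exact Int.measurable_floor.comp (by fun_prop)
    exact (measurable_of_countable p).comp hr
  -- Rounding `N x - α` recovers the index of a lattice point and gives a measurable phase on `ℝ`.
  have hphase : ∀ j, p (round ((N : ℝ) * latticePoint N α j - α)) = p j := fun j => by
    rw [mul_latticePoint hN, add_sub_cancel_right, round_intCast]
  have hloc : IsLocallyFiniteMeasure
      (Measure.sum fun j => ENNReal.ofReal ‖c j‖ • Measure.dirac (latticePoint N α j)) := by
    refine ⟨fun x => ⟨Set.Icc (x - 1) (x + 1), Icc_mem_nhds (by linarith) (by linarith), ?_⟩⟩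
    have hfin := finite_preimage_latticePoint hN α (x - 1) (x + 1)
    rw [Measure.sum_apply _ measurableSet_Icc, tsum_eq_sum (s := hfin.toFinset)]
    · refine ENNReal.sum_lt_top.2 fun j _ => ?_
      rw [Measure.smul_apply, smul_eq_mul]
      exact ENNReal.mul_lt_top ENNReal.ofReal_lt_top (measure_lt_top _ _)
    · intro j hj
      rw [Set.Finite.mem_toFinset, Set.mem_ofPred_eq] at hj
      rw [Measure.smul_apply, Measure.dirac_apply' _ measurableSet_Icc,
        Set.indicator_of_notMem hj, smul_zero]
  have htop : ∀ j, ENNReal.ofReal ‖c j‖ ≠ ⊤ := fun _ => ENNReal.ofReal_ne_top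
  refine ⟨⟨_, hloc, _, hmeas, fun x => hp _⟩, fun k hk => ?_⟩
  have hk' : Summable fun j => (ENNReal.ofReal ‖c j‖).toReal *
      ‖k (latticePoint N α j) * p (round ((N : ℝ) * latticePoint N α j - α))‖ := by
    refine hk.congr fun j => ?_
    rw [norm_mul, norm_mul, hp, mul_one, ENNReal.toReal_ofReal (norm_nonneg _)]
  have hI := integrable_sum_dirac (x := latticePoint N α)
    (f := fun x : ℝ => k x * p (round ((N : ℝ) * x - α))) htop hk'
  have hE := integral_sum_dirac_eq_tsum (x := latticePoint N α)
    (f := fun x : ℝ => k x * p (round ((N : ℝ) * x - α))) htop hk'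
  refine ⟨hI, hE.trans (tsum_congr fun j => ?_)⟩
  simp only [hphase, ENNReal.toReal_ofReal (norm_nonneg _), Complex.real_smul]
  rw [mul_left_comm, hpc, mul_comm]

/-- The kernel at a lattice point is an exponential in `z`, up to a constant depending on `j` and a
Gaussian factor in `z` that does not involve `j`. -/
theorem bargmannKernel_latticePoint {ħ : ℝ} (hN : 1 ≤ N) (hħ : 2 * Real.pi * ħ = 1 / (N : ℝ))
    (α : ℝ) (j : ℤ) (z : ℂ) :
    bargmannKernel ħ z (latticePoint N α j) =
      (((Real.pi * ħ) ^ (-(1 / 4 : ℝ)) : ℝ) : ℂ) *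
        Complex.exp (-((latticePoint N α j : ℂ) ^ 2 / (2 * ħ))) *
        (Complex.exp (-(z ^ 2 / (2 * ħ))) *
          Complex.exp (2 * Real.pi * (Real.sqrt 2 : ℝ) * (j + α) * z)) := by
  have hħ₀ := planck_pos hN hħ
  have hc : (ħ : ℂ) ≠ 0 := by exact_mod_cast hħ₀.ne'
  have hx : (N : ℂ) * latticePoint N α j = j + α := by
    exact_mod_cast congrArg (fun x : ℝ => (x : ℂ)) (mul_latticePoint hN α j)
  rw [bargmannKernel, ← Complex.exp_add, mul_assoc _ (Complex.exp _), ← Complex.exp_add]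
  congr 2
  rw [← hx]
  have h1 := planck_mul_complex hN hħ
  field_simp
  linear_combination (-2 * (Real.sqrt 2 : ℝ) * latticePoint N α j * z) * h1

/-- Every function in the fiber has a position representation: after removal of the Gaussian
factor `exp (-z² / 2ħ)` and of a character it is periodic in the imaginary direction, and the terms
of its Fourier series are the kernels at the lattice points. -/
theorem exists_represents {ħ : ℝ} (hN : 1 ≤ N) (hħ : 2 * Real.pi * ħ = 1 / (N : ℝ)) {θ : ℝ × ℝ}
    {φ : ℂ → ℂ} (hφ : φ ∈ fiber ħ N θ) : ∃ Ψ : PositionWave, Ψ.Represents ħ φ := by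
  obtain ⟨hd, hX, -⟩ := (mem_fiber_iff hN hħ).1 hφ
  have hħ₀ := planck_pos hN hħ
  have hc : (ħ : ℂ) ≠ 0 := by exact_mod_cast hħ₀.ne'
  set s : ℂ := ((Real.sqrt 2 : ℝ) : ℂ) with hs
  have hs2 : s ^ 2 = 2 := sqrt_two_sq
  -- In the variable `w` with `z = i w / √2` the imaginary period is `1`; the character makes the
  -- function strictly periodic.
  let F : ℂ → ℂ := fun w => Complex.exp (-(2 * Real.pi * Complex.I * θ.1 * w)) *
    (Complex.exp ((Complex.I * (s / 2) * w) ^ 2 / (2 * ħ)) * φ (Complex.I * (s / 2) * w))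
  have hF : Differentiable ℂ F := by
    have : Differentiable ℂ fun w => φ (Complex.I * (s / 2) * w) :=
      hd.comp (by fun_prop)
    simp only [F]
    fun_prop
  have hp : ∀ w, F (w + 1) = F w := by
    intro w
    have h := hX (Complex.I * (s / 2) * w)
    rw [translation_apply, ← Complex.conj_mul'] at h
    have e : Complex.I * (s / 2) * w - -(Complex.I * (s / 2)) = Complex.I * (s / 2) * (w + 1) := by
      ring
    rw [e] at h
    have h' : φ (Complex.I * (s / 2) * w) = Complex.exp (-(2 * Real.pi * Complex.I * θ.1)) *
        (Complex.exp (2 * Real.pi * Complex.I * θ.1) * φ (Complex.I * (s / 2) * w)) := by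
      rw [← mul_assoc, ← Complex.exp_add]
      simp
    simp only [F]
    rw [h', ← h, ← mul_assoc, ← mul_assoc, ← mul_assoc, ← mul_assoc, ← Complex.exp_add,
      ← Complex.exp_add, ← Complex.exp_add, ← Complex.exp_add]
    congr 2
    simp only [map_neg, map_mul, map_div₀, Complex.conj_I, hs, Complex.conj_ofReal, map_ofNat]
    simp only [← hs]
    field_simp
    ring
  obtain ⟨d, hdF⟩ := exists_hasSum_exp_of_periodic hF hp
  set K : ℂ := (((Real.pi * ħ) ^ (-(1 / 4 : ℝ)) : ℝ) : ℂ) with hK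
  have hK0 : K ≠ 0 := by
    rw [hK]
    exact_mod_cast (Real.rpow_pos_of_pos (by positivity) _).ne'
  -- The factor undoes the `j`-dependent constant in `B(z, x_j)`.
  let c : ℤ → ℂ := fun j =>
    d j * (K⁻¹ * Complex.exp ((latticePoint N θ.1 j : ℂ) ^ 2 / (2 * ħ)))
  have hterm : ∀ (j : ℤ) (z : ℂ), c j * bargmannKernel ħ z (latticePoint N θ.1 j) =
      Complex.exp (-(z ^ 2 / (2 * ħ))) * (Complex.exp (2 * Real.pi * Complex.I * θ.1 *
        (-(Complex.I * s * z))) *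
        (d j * Complex.exp (2 * Real.pi * Complex.I * j * (-(Complex.I * s * z))))) := by
    intro j z
    rw [bargmannKernel_latticePoint hN hħ]
    have e1 : Complex.exp (2 * Real.pi * (Real.sqrt 2 : ℝ) * (j + θ.1) * z) =
        Complex.exp (2 * Real.pi * Complex.I * θ.1 * (-(Complex.I * s * z))) *
          Complex.exp (2 * Real.pi * Complex.I * j * (-(Complex.I * s * z))) := by
      rw [← Complex.exp_add]
      congr 1
      linear_combination (2 * Real.pi * s * (j + θ.1) * z) * Complex.I_sq
    have e2 : Complex.exp ((latticePoint N θ.1 j : ℂ) ^ 2 / (2 * ħ)) *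
        Complex.exp (-((latticePoint N θ.1 j : ℂ) ^ 2 / (2 * ħ))) = 1 := by
      rw [← Complex.exp_add]; simp
    rw [e1, ← hK]
    simp only [c]
    calc _ = (K⁻¹ * K) * (Complex.exp ((latticePoint N θ.1 j : ℂ) ^ 2 / (2 * ħ)) *
        Complex.exp (-((latticePoint N θ.1 j : ℂ) ^ 2 / (2 * ħ)))) * (d j *
          (Complex.exp (-(z ^ 2 / (2 * ħ))) *
            (Complex.exp (2 * Real.pi * Complex.I * θ.1 * (-(Complex.I * s * z))) *
          Complex.exp (2 * Real.pi * Complex.I * j * (-(Complex.I * s * z)))))) := by ring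
      _ = _ := by rw [e2, inv_mul_cancel₀ hK0]; ring
  have hsum : ∀ z : ℂ,
      HasSum (fun j => c j * bargmannKernel ħ z (latticePoint N θ.1 j)) (φ z) := by
    intro z
    rw [funext fun j => hterm j z]
    have h := ((hdF (-(Complex.I * s * z))).mul_left (Complex.exp (2 * Real.pi * Complex.I * θ.1 *
        (-(Complex.I * s * z))))).mul_left (Complex.exp (-(z ^ 2 / (2 * ħ))))
    have hz : Complex.I * (s / 2) * (-(Complex.I * s * z)) = z := by
      linear_combination (-(s ^ 2 / 2) * z) * Complex.I_sq + (z / 2) * hs2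
    have hval : Complex.exp (-(z ^ 2 / (2 * ħ))) * (Complex.exp (2 * Real.pi * Complex.I * θ.1 *
        (-(Complex.I * s * z))) * F (-(Complex.I * s * z))) = φ z := by
      simp only [F]
      rw [hz, ← mul_assoc, ← mul_assoc, ← mul_assoc, ← Complex.exp_add, ← Complex.exp_add,
        ← Complex.exp_add, show ∀ a b : ℂ, -a + b + -b + a = 0 from fun a b => by ring,
        Complex.exp_zero, one_mul]
    rwa [hval] at h
  obtain ⟨Ψ, hΨ⟩ := exists_comb hN θ.1 c
  refine ⟨Ψ, fun z => ?_⟩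
  obtain ⟨h1, h2⟩ := hΨ (fun x => bargmannKernel ħ z x) (hsum z).summable.norm
  exact ⟨h1, h2.trans (hsum z).tsum_eq⟩

end

/-! ### Position representations are quasi-periodic combs -/

section

variable {N : ℕ} {ħ : ℝ} {θ : ℝ × ℝ} {φ : ℂ → ℂ} {Ψ : PositionWave}

/-- The mass of a position representation lives on the lattice: `X φ = exp (2 π i θ₁) φ` says that
`(exp (i x / ħ) - exp (2 π i θ₁)) Ψ` has vanishing Bargmann transform. -/
theorem PositionWave.Represents.ae_mem_range (hN : 1 ≤ N) (hħ : 2 * Real.pi * ħ = 1 / (N : ℝ))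
    (hφ : φ ∈ fiber ħ N θ) (hΨ : Ψ.Represents ħ φ) :
    ∀ᵐ x ∂Ψ.mass, x ∈ Set.range (latticePoint N θ.1) := by
  have hħ₀ := planck_pos hN hħ
  have hħc : (ħ : ℂ) ≠ 0 := by exact_mod_cast hħ₀.ne'
  obtain ⟨-, hX, -⟩ := (mem_fiber_iff hN hħ).1 hφ
  set m : ℝ → ℂ := fun x =>
    Complex.exp (Complex.I * x / ħ) - Complex.exp (2 * Real.pi * Complex.I * θ.1) with hm
  have hm_cont : Continuous m := by rw [hm]; fun_prop
  have hm_bdd : ∀ x, ‖m x‖ ≤ 2 := fun x => by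
    refine (norm_sub_le _ _).trans (le_of_eq ?_)
    rw [show Complex.I * x / ħ = ((x / ħ : ℝ) : ℂ) * Complex.I by push_cast; ring,
      show 2 * Real.pi * Complex.I * θ.1 = ((2 * Real.pi * θ.1 : ℝ) : ℂ) * Complex.I by
        push_cast; ring, Complex.norm_exp_ofReal_mul_I, Complex.norm_exp_ofReal_mul_I]
    norm_num
  have hzero : ∀ z, ∫ x, m x * (bargmannKernel ħ z x * Ψ.phase x) ∂Ψ.mass = 0 := by
    intro z
    have h := hX z
    have hφe : φ = fun w => ∫ x, bargmannKernel ħ w x * Ψ.phase x ∂Ψ.mass :=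
      funext fun w => (hΨ w).2.symm
    conv_lhs at h => rw [hφe, translation_integral]
    simp only [translation_bargmannKernel_im ħ] at h
    rw [← (hΨ z).2, ← integral_const_mul, ← sub_eq_zero, ← integral_sub] at h
    · rw [← h]
      refine integral_congr_ae (Filter.Eventually.of_forall fun x => ?_)
      simp only [hm]
      ring
    · simp only [mul_assoc]
      refine (hΨ z).1.bdd_mul (c := 1) (by fun_prop)
        (Filter.Eventually.of_forall fun x => le_of_eq ?_)
      rw [show Complex.I * x / ħ = ((x / ħ : ℝ) : ℂ) * Complex.I by push_cast; ring,
        Complex.norm_exp_ofReal_mul_I]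
    · exact (hΨ z).1.const_mul _
  -- Frequency zero shows that the Gaussian times `Ψ` is a finite complex measure.
  have hG : Integrable (fun x : ℝ => m x * ((Real.exp (-(x ^ 2 / (2 * ħ))) : ℂ) * Ψ.phase x))
      Ψ.mass := by
    obtain ⟨z, C, hC, hB⟩ := exists_bargmannKernel_eq hħ₀ 0
    refine Integrable.bdd_mul (c := 2) ?_ hm_cont.aestronglyMeasurable
      (Filter.Eventually.of_forall hm_bdd)
    refine ((hΨ z).1.const_mul C⁻¹).congr (Filter.Eventually.of_forall fun x => ?_)
    simp only [hB]
    field_simp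
    simp
  have := ae_eq_zero_of_fourier_eq_zero hG (fun t => by
    obtain ⟨z, C, hC, hB⟩ := exists_bargmannKernel_eq hħ₀ t
    have h := hzero z
    simp only [hB] at h
    rw [← mul_right_inj' hC, mul_zero, ← integral_const_mul, ← h]
    refine integral_congr_ae (Filter.Eventually.of_forall fun x => ?_)
    simp only
    ring)
  filter_upwards [this] with x hx
  have hphase : Ψ.phase x ≠ 0 := by
    rw [← norm_ne_zero_iff, Ψ.norm_phase]; exact one_ne_zero
  have hmx : m x = 0 := by
    simpa [hphase] using hx
  rw [hm] at hmx
  obtain ⟨n, hn⟩ := Complex.exp_eq_exp_iff_exists_int.1 (sub_eq_zero.1 hmx)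
  refine ⟨n, latticePoint_of_mul_eq hN ?_⟩
  have h1 := planck_mul_complex hN hħ
  have : (N * x : ℂ) = n + θ.1 := by
    have h2 : (2 * Real.pi * Complex.I : ℂ) ≠ 0 := Complex.two_pi_I_ne_zero
    have h3 : Complex.I * x / ħ = 2 * Real.pi * Complex.I * (N * x) := by
      field_simp
      linear_combination (-(x : ℂ)) * h1
    rw [h3] at hn
    apply mul_left_cancel₀ h2
    linear_combination hn
  exact_mod_cast this

/-- The coefficients of the comb underlying a position wave supported on the lattice. -/
noncomputable def combCoeff (Ψ : PositionWave) (N : ℕ) (α : ℝ) (j : ℤ) : ℂ :=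
  (Ψ.mass.real {latticePoint N α j} : ℂ) * Ψ.phase (latticePoint N α j)

theorem mass_singleton_ne_top (Ψ : PositionWave) (x : ℝ) : Ψ.mass {x} ≠ ⊤ := by
  have := Ψ.locallyFinite
  exact isCompact_singleton.measure_lt_top.ne

/-- A position wave supported on the lattice is the comb of its atoms. -/
theorem mass_eq_sum_dirac (hN : 1 ≤ N) {α : ℝ}
    (h : ∀ᵐ x ∂Ψ.mass, x ∈ Set.range (latticePoint N α)) :
    Ψ.mass = Measure.sum fun j =>
      Ψ.mass {latticePoint N α j} • Measure.dirac (latticePoint N α j) := by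
  conv_lhs => rw [← Measure.restrict_eq_self_of_ae_mem h, ← Set.iUnion_singleton_eq_range]
  rw [Measure.restrict_iUnion]
  · simp only [Measure.restrict_singleton]
  · intro i j hij
    simpa using fun h => hij (latticePoint_injective hN α h)
  · exact fun j => measurableSet_singleton _

theorem integrable_iff_summable_combCoeff (hN : 1 ≤ N) {α : ℝ}
    (h : ∀ᵐ x ∂Ψ.mass, x ∈ Set.range (latticePoint N α)) (k : ℝ → ℂ) :
    Integrable (fun x => k x * Ψ.phase x) Ψ.mass ↔
      Summable fun j => ‖combCoeff Ψ N α j * k (latticePoint N α j)‖ := by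
  rw [mass_eq_sum_dirac hN h, integrable_sum_dirac_iff fun j => mass_singleton_ne_top Ψ _]
  refine summable_congr fun j => ?_
  rw [combCoeff, norm_mul, norm_mul, norm_mul, Ψ.norm_phase, mul_one, mul_one, Complex.norm_real,
    Real.norm_of_nonneg measureReal_nonneg, measureReal_def]

theorem integral_eq_tsum_combCoeff (hN : 1 ≤ N) {α : ℝ}
    (h : ∀ᵐ x ∂Ψ.mass, x ∈ Set.range (latticePoint N α)) (k : ℝ → ℂ) :
    ∫ x, k x * Ψ.phase x ∂Ψ.mass = ∑' j, combCoeff Ψ N α j * k (latticePoint N α j) := by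
  conv_lhs => rw [mass_eq_sum_dirac hN h]
  rw [integral_sum_dirac fun j => mass_singleton_ne_top Ψ _]
  refine tsum_congr fun j => ?_
  rw [combCoeff, Complex.real_smul, measureReal_def]
  ring

theorem PositionWave.Represents.summable_norm (hN : 1 ≤ N) (hħ : 2 * Real.pi * ħ = 1 / (N : ℝ))
    (hφ : φ ∈ fiber ħ N θ) (hΨ : Ψ.Represents ħ φ) (z : ℂ) :
    Summable fun j => ‖combCoeff Ψ N θ.1 j * bargmannKernel ħ z (latticePoint N θ.1 j)‖ :=
  (integrable_iff_summable_combCoeff hN (hΨ.ae_mem_range hN hħ hφ) _).1 (hΨ z).1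

theorem PositionWave.Represents.hasSum (hN : 1 ≤ N) (hħ : 2 * Real.pi * ħ = 1 / (N : ℝ))
    (hφ : φ ∈ fiber ħ N θ) (hΨ : Ψ.Represents ħ φ) (z : ℂ) :
    HasSum (fun j => combCoeff Ψ N θ.1 j * bargmannKernel ħ z (latticePoint N θ.1 j)) (φ z) := by
  have h := (hΨ.summable_norm hN hħ hφ z).of_norm.hasSum
  rwa [← integral_eq_tsum_combCoeff hN (hΨ.ae_mem_range hN hħ hφ)
    (fun x => bargmannKernel ħ z x), (hΨ z).2] at h

/-- The eigenvalue equation for `Y` makes the coefficients quasi-periodic. -/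
theorem PositionWave.Represents.combCoeff_sub (hN : 1 ≤ N) (hħ : 2 * Real.pi * ħ = 1 / (N : ℝ))
    (hφ : φ ∈ fiber ħ N θ) (hΨ : Ψ.Represents ħ φ) (j : ℤ) :
    combCoeff Ψ N θ.1 (j - N) =
      Complex.exp (2 * Real.pi * Complex.I * θ.2) * combCoeff Ψ N θ.1 j := by
  have hħ₀ := planck_pos hN hħ
  obtain ⟨-, -, hY⟩ := (mem_fiber_iff hN hħ).1 hφ
  set c := combCoeff Ψ N θ.1 with hc
  set u := Complex.exp (2 * Real.pi * Complex.I * θ.2) with hu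
  have hS := hΨ.hasSum hN hħ hφ
  rw [← hc] at hS
  have hshift : ∀ j : ℤ, latticePoint N θ.1 (j - N) + 1 = latticePoint N θ.1 j := fun j => by
    have := latticePoint_add_mul hN θ.1 j (-1)
    rw [show j + -1 * (N : ℤ) = j - N by ring] at this
    rw [this]; push_cast; ring
  have hS1 : ∀ z, HasSum (fun j => c (j - N) * bargmannKernel ħ z (latticePoint N θ.1 j))
      (u * φ z) := by
    intro z
    have h := (hS (z - (Real.sqrt 2 : ℝ) / 2)).mul_left
      (Complex.exp ((conj ((Real.sqrt 2 : ℝ) / 2 : ℂ) * z -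
        (‖((Real.sqrt 2 : ℝ) / 2 : ℂ)‖ : ℂ) ^ 2 / 2) / ħ))
    rw [← translation_apply, hY z] at h
    rw [← (Equiv.subRight (N : ℤ)).hasSum_iff] at h
    refine h.congr_fun fun j => ?_
    have hk := translation_bargmannKernel_re ħ (latticePoint N θ.1 (j - N)) z
    rw [hshift, translation_apply] at hk
    simp only [Function.comp_apply, Equiv.subRight_apply]
    rw [← hk]
    ring
  -- The difference of the two combs has vanishing Bargmann transform, hence zero coefficients.
  have hD : ∀ z, HasSum (fun j => (c (j - N) - u * c j) * bargmannKernel ħ z (latticePoint N θ.1 j))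
      0 := by
    intro z
    have h := (hS1 z).sub ((hS z).mul_left u)
    rw [sub_self] at h
    exact h.congr_fun fun j => by ring
  have hne : ∀ j, (Real.exp (-(latticePoint N θ.1 j ^ 2 / (2 * ħ))) : ℂ) ≠ 0 := fun j => by
    exact_mod_cast (Real.exp_pos _).ne'
  have h0 := eq_zero_of_forall_tsum_exp_eq_zero
    (d := fun j => (c (j - N) - u * c j) *
      (Real.exp (-(latticePoint N θ.1 j ^ 2 / (2 * ħ))) : ℂ)) (by
      obtain ⟨z, C, hC, hB⟩ := exists_bargmannKernel_eq hħ₀ 0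
      refine ((hD z).mul_left C⁻¹).summable.norm.congr fun j => ?_
      rw [hB]
      congr 1
      field_simp
      simp) (fun t => by
      -- At frequency `N t` the character at `x_j` is `exp (i t j)` up to a constant phase.
      obtain ⟨z, C, hC, hB⟩ := exists_bargmannKernel_eq hħ₀ (N * t)
      refine HasSum.tsum_eq ?_
      have h := (hD z).mul_left (C * Complex.exp (t * θ.1 * Complex.I))⁻¹
      rw [mul_zero] at h
      refine h.congr_fun fun j => ?_
      rw [hB]
      have e : Complex.exp ((N * t : ℝ) * latticePoint N θ.1 j * Complex.I) =
          Complex.exp (t * j * Complex.I) * Complex.exp (t * θ.1 * Complex.I) := by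
        rw [← Complex.exp_add]
        congr 1
        have hx : (N : ℂ) * latticePoint N θ.1 j = j + θ.1 := by
          exact_mod_cast congrArg (fun x : ℝ => (x : ℂ)) (mul_latticePoint hN θ.1 j)
        push_cast
        linear_combination (t * Complex.I) * hx
      rw [e]
      have := Complex.exp_ne_zero (t * θ.1 * Complex.I)
      field_simp) j
  exact sub_eq_zero.1 ((mul_eq_zero.1 h0).resolve_right (hne j))

end

/-! ### The pairing through the kernel `K` -/

section

variable {N : ℕ} {ħ : ℝ} {θ : ℝ × ℝ} {φ φ₁ φ₂ : ℂ → ℂ} {Ψ Ψ₁ Ψ₂ : PositionWave}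

theorem PositionWave.Represents.conj_mul_combCoeff_sub (hN : 1 ≤ N)
    (hħ : 2 * Real.pi * ħ = 1 / (N : ℝ))
    (hφ₁ : φ₁ ∈ fiber ħ N θ) (hΨ₁ : Ψ₁.Represents ħ φ₁)
    (hφ₂ : φ₂ ∈ fiber ħ N θ) (hΨ₂ : Ψ₂.Represents ħ φ₂) (j : ℤ) :
    conj (combCoeff Ψ₁ N θ.1 (j - N)) * combCoeff Ψ₂ N θ.1 (j - N) =
      conj (combCoeff Ψ₁ N θ.1 j) * combCoeff Ψ₂ N θ.1 j := by
  rw [hΨ₁.combCoeff_sub hN hħ hφ₁, hΨ₂.combCoeff_sub hN hħ hφ₂, map_mul,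
    mul_mul_mul_comm, Complex.conj_mul',
    show 2 * Real.pi * Complex.I * θ.2 = ((2 * Real.pi * θ.2 : ℝ) : ℂ) * Complex.I by
      push_cast; ring, Complex.norm_exp_ofReal_mul_I]
  simp

theorem PositionWave.Represents.conj_mul_combCoeff_periodic (hN : 1 ≤ N)
    (hħ : 2 * Real.pi * ħ = 1 / (N : ℝ))
    (hφ₁ : φ₁ ∈ fiber ħ N θ) (hΨ₁ : Ψ₁.Represents ħ φ₁)
    (hφ₂ : φ₂ ∈ fiber ħ N θ) (hΨ₂ : Ψ₂.Represents ħ φ₂) :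
    Function.Periodic
      (fun j => conj (combCoeff Ψ₁ N θ.1 j) * combCoeff Ψ₂ N θ.1 j) (N : ℤ) := fun j => by
  have := hΨ₁.conj_mul_combCoeff_sub hN hħ hφ₁ hφ₂ hΨ₂ (j + N)
  rw [add_sub_cancel_right] at this
  exact this.symm

/-- The coefficients are bounded, their absolute values being periodic. -/
theorem PositionWave.Represents.exists_norm_combCoeff_le (hN : 1 ≤ N)
    (hħ : 2 * Real.pi * ħ = 1 / (N : ℝ))
    (hφ : φ ∈ fiber ħ N θ) (hΨ : Ψ.Represents ħ φ) :
    ∃ M : ℝ, 0 ≤ M ∧ ∀ j, ‖combCoeff Ψ N θ.1 j‖ ≤ M := by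
  have hN0 : (0 : ℤ) < N := by exact_mod_cast hN
  have hper : Function.Periodic (fun j => ‖combCoeff Ψ N θ.1 j‖ ^ 2) (N : ℤ) := fun j => by
    have := hΨ.conj_mul_combCoeff_periodic hN hħ hφ hφ hΨ j
    simp only [Complex.conj_mul'] at this
    exact_mod_cast this
  refine ⟨∑ k ∈ Finset.Ico (0 : ℤ) N, ‖combCoeff Ψ N θ.1 k‖,
    Finset.sum_nonneg fun _ _ => norm_nonneg _, fun j => ?_⟩
  have hj : ‖combCoeff Ψ N θ.1 j‖ = ‖combCoeff Ψ N θ.1 (j % N)‖ := by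
    have h := hper.sub_zsmul_eq (x := j) (j / N)
    rw [smul_eq_mul, mul_comm, ← Int.emod_def] at h
    exact (sq_eq_sq₀ (norm_nonneg _) (norm_nonneg _)).1 h.symm
  rw [hj]
  exact Finset.single_le_sum (f := fun k => ‖combCoeff Ψ N θ.1 k‖) (fun _ _ => norm_nonneg _)
    (Finset.mem_Ico.2 ⟨Int.emod_nonneg _ hN0.ne', Int.emod_lt_of_pos _ hN0⟩)

/-- Gaussian sums over the lattice converge; they are theta series. -/
theorem summable_gaussian_latticePoint (hN : 1 ≤ N) (α x : ℝ) {a : ℝ} (ha : 0 < a) :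
    Summable fun j => Real.exp (-(a * (x - latticePoint N α j) ^ 2)) := by
  have hN' : (0 : ℝ) < N := by positivity
  -- Completing the square turns the sum into the series of norms of a two-variable theta function.
  set β : ℝ := α - N * x with hβ
  set τ : ℂ := ((a / (N ^ 2 * Real.pi) : ℝ) : ℂ) * Complex.I with hτ
  set z : ℂ := ((a * β / (N ^ 2 * Real.pi) : ℝ) : ℂ) * Complex.I with hz
  have h := ((summable_jacobiTheta₂_term_iff z τ).2 (by
    simp only [hτ, Complex.mul_im, Complex.ofReal_re, Complex.I_im, Complex.ofReal_im,
      Complex.I_re, mul_one, mul_zero, add_zero]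
    positivity)).norm.mul_left (Real.exp (-(a * β ^ 2 / N ^ 2)))
  refine h.congr fun j => ?_
  rw [norm_jacobiTheta₂_term, ← Real.exp_add]
  congr 1
  have hx : latticePoint N α j = (j + α) / N := rfl
  simp only [hτ, hz, hβ, hx, Complex.mul_im, Complex.ofReal_re, Complex.I_im, Complex.ofReal_im,
      Complex.I_re, mul_one, mul_zero, add_zero]
  field_simp
  ring

theorem norm_kernelK_le (hħ₀ : 0 < ħ) (x y : ℝ) :
    ‖kernelK ħ x y‖ ≤ (2 * Real.pi * ħ)⁻¹ * Real.exp (-(1 / (4 * ħ) * (x - y) ^ 2)) := by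
  rw [kernelK, gFun, norm_mul, norm_mul, Complex.norm_real, Complex.norm_real,
    Real.norm_of_nonneg (by positivity), Real.norm_eq_abs, Complex.norm_exp]
  refine (mul_le_of_le_one_right (by positivity) (Real.abs_sinc_le_one _)).trans (le_of_eq ?_)
  congr 2
  rw [show -(ħ : ℂ) * (((x - y) / (2 * ħ) : ℝ) : ℂ) ^ 2 =
    ((-ħ * ((x - y) / (2 * ħ)) ^ 2 : ℝ) : ℂ) by push_cast; ring]
  simp only [Complex.add_re, Complex.ofReal_re, Complex.mul_re, Complex.I_re, Complex.I_im,
    Complex.ofReal_im, zero_mul, mul_zero, sub_zero, add_zero]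
  field_simp
  ring

/-- On the lattice the kernel `K` is `N` times the identity, since `sin r / r` vanishes at the
nonzero multiples of `π`. -/
theorem kernelK_latticePoint (hN : 1 ≤ N) (hħ : 2 * Real.pi * ħ = 1 / (N : ℝ)) (α : ℝ) (i j : ℤ) :
    kernelK ħ (latticePoint N α i) (latticePoint N α j) = if j = i then (N : ℂ) else 0 := by
  have hħ₀ := planck_pos hN hħ
  have hmul := planck_mul hN hħ
  have hr : (latticePoint N α i - latticePoint N α j) / (2 * ħ) = ((i - j : ℤ) : ℝ) * Real.pi := by
    have h1 := mul_latticePoint hN α i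
    have h2 := mul_latticePoint hN α j
    rw [div_eq_iff (by positivity)]
    push_cast
    linear_combination (2 * Real.pi * ħ) * (h1 - h2) -
      (latticePoint N α i - latticePoint N α j) * hmul
  rw [kernelK, hr, gFun]
  split_ifs with h
  · subst h
    simp only [sub_self, Int.cast_zero, zero_mul, Complex.ofReal_zero, Real.sinc_zero]
    rw [hħ]
    simp
  · have hne : ((i - j : ℤ) : ℝ) * Real.pi ≠ 0 :=
      mul_ne_zero (by exact_mod_cast sub_ne_zero.2 (Ne.symm h)) Real.pi_ne_zero
    rw [Real.sinc_of_ne_zero hne, Real.sin_int_mul_pi]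
    simp

theorem PositionWave.Represents.integrable_kernelK (hN : 1 ≤ N) (hħ : 2 * Real.pi * ħ = 1 / (N : ℝ))
    (hφ : φ ∈ fiber ħ N θ) (hΨ : Ψ.Represents ħ φ) (x : ℝ) :
    Integrable (fun y : ℝ => kernelK ħ x y * Ψ.phase y) Ψ.mass := by
  have hħ₀ := planck_pos hN hħ
  rw [integrable_iff_summable_combCoeff hN (hΨ.ae_mem_range hN hħ hφ)]
  obtain ⟨M, hM0, hM⟩ := hΨ.exists_norm_combCoeff_le hN hħ hφ
  refine Summable.of_nonneg_of_le (fun _ => norm_nonneg _) (fun j => ?_)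
    (((summable_gaussian_latticePoint hN θ.1 x (a := 1 / (4 * ħ)) (by positivity)).mul_left
      (2 * Real.pi * ħ)⁻¹).mul_left M)
  rw [norm_mul]
  exact mul_le_mul (hM j) (norm_kernelK_le hħ₀ _ _) (norm_nonneg _) hM0

theorem PositionWave.Represents.applyK_latticePoint (hN : 1 ≤ N)
    (hħ : 2 * Real.pi * ħ = 1 / (N : ℝ))
    (hφ : φ ∈ fiber ħ N θ) (hΨ : Ψ.Represents ħ φ) (i : ℤ) :
    applyK ħ Ψ (latticePoint N θ.1 i) = N * combCoeff Ψ N θ.1 i := by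
  rw [applyK, integral_eq_tsum_combCoeff hN (hΨ.ae_mem_range hN hħ hφ), tsum_eq_single i]
  · rw [kernelK_latticePoint hN hħ, if_pos rfl, mul_comm]
  · intro j hj
    rw [kernelK_latticePoint hN hħ, if_neg hj, mul_zero]

theorem latticePoint_mem_Ico_iff (hN : 1 ≤ N) (α : ℝ) (j : ℤ) :
    latticePoint N α j ∈ Set.Ico (0 : ℝ) 1 ↔ j ∈ Finset.Ico ⌈-α⌉ (⌈-α⌉ + N) := by
  have hN' : (0 : ℝ) < N := by positivity
  rw [Set.mem_Ico, Finset.mem_Ico, ← mul_nonneg_iff_of_pos_left hN',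
    ← mul_lt_mul_iff_right₀ (b := latticePoint N α j) hN', mul_latticePoint hN, Int.ceil_le,
    ← sub_lt_iff_lt_add, Int.lt_ceil]
  push_cast
  constructor <;> rintro ⟨h1, h2⟩ <;> constructor <;> linarith

/-- The pairing on the unit interval is a finite sum over the lattice points in `[0, 1)`. -/
theorem PositionWave.Represents.unitPairing_eq (hN : 1 ≤ N) (hħ : 2 * Real.pi * ħ = 1 / (N : ℝ))
    (hφ₁ : φ₁ ∈ fiber ħ N θ) (hΨ₁ : Ψ₁.Represents ħ φ₁)
    (hφ₂ : φ₂ ∈ fiber ħ N θ) (hΨ₂ : Ψ₂.Represents ħ φ₂) :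
    IntegrableOn (fun x : ℝ => conj (Ψ₁.phase x) * applyK ħ Ψ₂ x) (Set.Ico (0 : ℝ) 1) Ψ₁.mass ∧
    unitPairing Ψ₁ (applyK ħ Ψ₂) = N * ∑ j ∈ Finset.Ico ⌈-θ.1⌉ (⌈-θ.1⌉ + N),
      conj (combCoeff Ψ₁ N θ.1 j) * combCoeff Ψ₂ N θ.1 j := by
  classical
  have hmass := mass_eq_sum_dirac hN (hΨ₁.ae_mem_range hN hħ hφ₁)
  have hout : ∀ j ∉ Finset.Ico ⌈-θ.1⌉ (⌈-θ.1⌉ + N),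
      (Set.Ico (0 : ℝ) 1).indicator (fun x => conj (Ψ₁.phase x) * applyK ħ Ψ₂ x)
        (latticePoint N θ.1 j) = 0 := fun j hj =>
    Set.indicator_of_notMem (by rwa [latticePoint_mem_Ico_iff hN]) _
  constructor
  · rw [← integrable_indicator_iff measurableSet_Ico, hmass]
    refine integrable_sum_dirac (fun j => mass_singleton_ne_top Ψ₁ _) ?_
    refine summable_of_ne_finset_zero (s := Finset.Ico ⌈-θ.1⌉ (⌈-θ.1⌉ + N)) fun j hj => ?_
    rw [hout j hj, norm_zero, mul_zero]
  · rw [unitPairing, ← integral_indicator measurableSet_Ico]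
    conv_lhs => rw [hmass]
    rw [integral_sum_dirac fun j => mass_singleton_ne_top Ψ₁ _,
      tsum_eq_sum (s := Finset.Ico ⌈-θ.1⌉ (⌈-θ.1⌉ + N)), Finset.mul_sum]
    · refine Finset.sum_congr rfl fun j hj => ?_
      rw [Set.indicator_of_mem (by rwa [latticePoint_mem_Ico_iff hN]),
        hΨ₂.applyK_latticePoint hN hħ hφ₂, Complex.real_smul]
      conv_rhs => rw [combCoeff, map_mul, Complex.conj_ofReal, measureReal_def]
      ring
    · intro j hj
      rw [hout j hj, smul_zero]

end

/-! ### The inner product of a fiber -/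

open scoped Pointwise in
/-- Integration over the fundamental domain in the coordinates `z = (x + i q) / √2`; the
coordinate `q` is minus the momentum. -/
theorem setIntegral_fundamentalDomain (f : ℂ → ℂ) :
    ∫ z in fundamentalDomain, f z = (1 / 2 : ℝ) •
      ∫ w in Set.Icc (0 : ℝ) 1 ×ˢ Set.Icc (-1 : ℝ) 0,
        f ((Real.sqrt 2 / 2 : ℝ) • ((w.1 : ℂ) + w.2 * Complex.I)) := by
  have hs : (Real.sqrt 2 / 2 : ℝ) ≠ 0 := by positivity
  have h2 : Real.sqrt 2 * Real.sqrt 2 = 2 := Real.mul_self_sqrt zero_le_two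
  have hset : (Real.sqrt 2 / 2 : ℝ) • (Set.Icc (0 : ℝ) 1 ×ℂ Set.Icc (-1 : ℝ) 0) =
      fundamentalDomain := by
    ext z
    have hinv : (Real.sqrt 2 / 2 : ℝ)⁻¹ = Real.sqrt 2 := by
      field_simp
      nlinarith
    rw [Set.mem_smul_set_iff_inv_smul_mem₀ hs, hinv, Complex.mem_reProdIm, Complex.real_smul,
      Complex.re_ofReal_mul, Complex.im_ofReal_mul, fundamentalDomain, Set.mem_ofPred_eq]
    simp only [Set.mem_Icc]
    constructor <;> rintro ⟨⟨h1, h2⟩, h3, h4⟩ <;> refine ⟨⟨?_, ?_⟩, ?_, ?_⟩ <;> linarith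
  have h := Measure.setIntegral_comp_smul_of_pos (volume : Measure ℂ) f
    (R := Real.sqrt 2 / 2) (Set.Icc (0 : ℝ) 1 ×ℂ Set.Icc (-1 : ℝ) 0) (by positivity)
  rw [hset, Complex.finrank_real_complex, div_pow, Real.sq_sqrt zero_le_two] at h
  have hE := Complex.volume_preserving_equiv_real_prod.symm.setIntegral_preimage_emb
    Complex.measurableEquivRealProd.symm.measurableEmbedding
    (fun w => f ((Real.sqrt 2 / 2 : ℝ) • w)) (Set.Icc (0 : ℝ) 1 ×ℂ Set.Icc (-1 : ℝ) 0)
  have hpre : Complex.measurableEquivRealProd.symm ⁻¹' (Set.Icc (0 : ℝ) 1 ×ℂ Set.Icc (-1 : ℝ) 0) =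
      Set.Icc (0 : ℝ) 1 ×ˢ Set.Icc (-1 : ℝ) 0 := by
    ext w
    rfl
  have hpt : ∀ w : ℝ × ℝ, Complex.measurableEquivRealProd.symm w =
      (w.1 : ℂ) + w.2 * Complex.I := fun w => by
    rw [← Complex.mk_eq_add_mul_I]; rfl
  rw [hpre] at hE
  simp only [hpt] at hE
  rw [hE, h, smul_smul]
  norm_num

theorem fiberInner_eq_setIntegral {ħ : ℝ} (hħ₀ : 0 < ħ) (φ₁ φ₂ : ℂ → ℂ) :
    fiberInner ħ φ₁ φ₂ = (Real.pi * ħ : ℂ)⁻¹ *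
      ∫ z in fundamentalDomain, (Real.exp (-‖z‖ ^ 2 / ħ) : ℂ) * (conj (φ₁ z) * φ₂ z) := by
  rw [fiberInner, bargmannMeasure, setIntegral_withDensity_eq_setIntegral_toReal_smul₀'
    fundamentalDomain (by fun_prop) (Filter.Eventually.of_forall fun _ => ENNReal.ofReal_lt_top),
    ← integral_const_mul]
  refine integral_congr_ae (Filter.Eventually.of_forall fun z => ?_)
  simp only
  rw [ENNReal.toReal_ofReal (by positivity), Complex.real_smul]
  push_cast
  ring

/-- The Gaussian factor of the kernel `B` at `x` in the position variable, centred at `b`. -/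
noncomputable def positionGaussian (ħ b x : ℝ) : ℝ := Real.exp (-((x - b) ^ 2 / (2 * ħ)))

/-- In the coordinates `z = (x + i q) / √2` the product of two kernels, weighted by the Gaussian of
the Bargmann measure, factors into a function of `x` and a character of `q`. -/
theorem conj_bargmannKernel_mul {ħ : ℝ} (hħ₀ : 0 < ħ) (a b x q : ℝ) :
    (Real.exp (-‖(Real.sqrt 2 / 2 : ℝ) • ((x : ℂ) + q * Complex.I)‖ ^ 2 / ħ) : ℂ) *
      (conj (bargmannKernel ħ ((Real.sqrt 2 / 2 : ℝ) • ((x : ℂ) + q * Complex.I)) a) *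
        bargmannKernel ħ ((Real.sqrt 2 / 2 : ℝ) • ((x : ℂ) + q * Complex.I)) b) =
      (((Real.pi * ħ) ^ (-(1 / 2 : ℝ)) : ℝ) : ℂ) *
        ((positionGaussian ħ a x * positionGaussian ħ b x : ℝ) *
          Complex.exp ((b - a) * q / ħ * Complex.I)) := by
  have hA : (((Real.pi * ħ) ^ (-(1 / 2 : ℝ)) : ℝ) : ℂ) =
      (((Real.pi * ħ) ^ (-(1 / 4 : ℝ)) : ℝ) : ℂ) * (((Real.pi * ħ) ^ (-(1 / 4 : ℝ)) : ℝ) : ℂ) := by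
    rw [← Complex.ofReal_mul, ← Real.rpow_add (by positivity)]
    norm_num
  have hn : ‖(Real.sqrt 2 / 2 : ℝ) • ((x : ℂ) + q * Complex.I)‖ ^ 2 = (x ^ 2 + q ^ 2) / 2 := by
    rw [norm_smul, mul_pow, Complex.sq_norm, Complex.normSq_add_mul_I, Real.norm_eq_abs, sq_abs,
      div_pow, Real.sq_sqrt zero_le_two]
    ring
  rw [hn, hA, bargmannKernel, bargmannKernel, map_mul, Complex.conj_ofReal, ← Complex.exp_conj,
    positionGaussian, positionGaussian, ← Real.exp_add]
  simp only [Complex.ofReal_exp]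
  rw [mul_mul_mul_comm, mul_left_comm, ← Complex.exp_add, ← Complex.exp_add, ← Complex.exp_add]
  congr 2
  simp only [Complex.real_smul, map_sub, map_add, map_mul, map_div₀, map_pow, Complex.conj_ofReal,
    Complex.conj_I, map_ofNat]
  push_cast
  linear_combination ((a * (x - q * Complex.I) / 2 + b * (x + q * Complex.I) / 2 -
    (x ^ 2 + q ^ 2 * Complex.I ^ 2) / 4) / ħ) * sqrt_two_sq - (q ^ 2 / 2 / ħ) * Complex.I_sq

theorem positionGaussian_nonneg (ħ b x : ℝ) : 0 ≤ positionGaussian ħ b x := (Real.exp_pos _).le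

/-- A bound uniform on `[0, 1]`, from `(x - b)² ≥ b² / 2 - x²`, that is summable over lattice points
`b`. -/
theorem positionGaussian_le {ħ : ℝ} (hħ₀ : 0 < ħ) (b : ℝ) {x : ℝ} (hx : x ∈ Set.Icc (0 : ℝ) 1) :
    positionGaussian ħ b x ≤ Real.exp (1 / (2 * ħ)) * Real.exp (-(1 / (4 * ħ) * (0 - b) ^ 2)) := by
  rw [positionGaussian, ← Real.exp_add, Real.exp_le_exp]
  have h1 : x ^ 2 ≤ 1 := by nlinarith [hx.1, hx.2]
  have h2 : (x - b) ^ 2 ≥ b ^ 2 / 2 - 1 := by nlinarith [sq_nonneg (2 * x - b)]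
  have e : 1 / (2 * ħ) + -(1 / (4 * ħ) * (0 - b) ^ 2) = -((b ^ 2 / 2 - 1) / (2 * ħ)) := by
    field_simp
    ring
  rw [e, neg_le_neg_iff]
  exact div_le_div_of_nonneg_right h2 (by positivity)

theorem setIntegral_exp_int (n : ℤ) :
    ∫ q in Set.Icc (-1 : ℝ) 0, Complex.exp (2 * Real.pi * n * q * Complex.I) =
      if n = 0 then 1 else 0 := by
  rw [integral_Icc_eq_integral_Ioc, ← intervalIntegral.integral_of_le (by norm_num)]
  split_ifs with h
  · simp [h]
  · have hc : (2 * Real.pi * n * Complex.I : ℂ) ≠ 0 := by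
      have : (n : ℂ) ≠ 0 := by exact_mod_cast h
      simp [Real.pi_ne_zero, this]
    have e : ∀ q : ℝ, Complex.exp (2 * Real.pi * n * q * Complex.I) =
        Complex.exp ((2 * Real.pi * n * Complex.I) * q) := fun q => by
      congr 1; ring
    simp only [e]
    rw [integral_exp_mul_complex hc, div_eq_zero_iff, sub_eq_zero]
    left
    rw [Complex.exp_eq_exp_iff_exists_int]
    exact ⟨n, by push_cast; ring⟩

/-- A sum over `ℤ` by residue classes modulo `N`, represented in any interval of length `N`. -/
theorem tsum_int_eq_sum_Ico {N : ℕ} (hN : 1 ≤ N) {f : ℤ → ℂ} (hf : Summable f) (m : ℤ) :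
    ∑' j, f j = ∑ r ∈ Finset.Ico m (m + N), ∑' n : ℤ, f (r + n * N) := by
  have : NeZero N := ⟨by omega⟩
  let e : Fin N × ℤ ≃ ℤ :=
    ((Equiv.prodComm _ _).trans (Int.divModEquiv N).symm).trans (Equiv.addLeft m)
  have he : ∀ p : Fin N × ℤ, e p = m + (p.1 : ℕ) + p.2 * N := fun p => by
    simp only [e, Equiv.trans_apply, Equiv.prodComm_apply, Prod.fst_swap, Prod.snd_swap,
      Int.divModEquiv_symm_apply, Equiv.coe_addLeft]
    ring
  have hfe : Summable fun p => f (e p) := e.summable_iff.2 hf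
  rw [← e.tsum_eq f, hfe.tsum_prod, tsum_fintype]
  simp only [he]
  rw [Fin.sum_univ_eq_sum_range (fun i : ℕ => ∑' n : ℤ, f (m + i + n * N)) N]
  refine Finset.sum_nbij' (fun i : ℕ => m + i) (fun r => (r - m).toNat) ?_ ?_ ?_ ?_ ?_
  · intro i hi
    rw [Finset.mem_range] at hi
    rw [Finset.mem_Ico]
    omega
  · intro r hr
    rw [Finset.mem_Ico] at hr
    rw [Finset.mem_range]
    omega
  · intro i _
    omega
  · intro r hr
    rw [Finset.mem_Ico] at hr
    omega
  · intro i _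
    rfl

section

variable {N : ℕ} {ħ : ℝ} {θ : ℝ × ℝ} {φ φ₁ φ₂ : ℂ → ℂ} {Ψ Ψ₁ Ψ₂ : PositionWave}

theorem latticePoint_sub_mul_div (hN : 1 ≤ N) (hħ : 2 * Real.pi * ħ = 1 / (N : ℝ)) (α : ℝ)
    (j k : ℤ) (q : ℝ) : ((latticePoint N α k : ℂ) - latticePoint N α j) * q / ħ =
      2 * Real.pi * (k - j : ℤ) * q := by
  have hħ₀ := planck_pos hN hħ
  have hc : (ħ : ℂ) ≠ 0 := by exact_mod_cast hħ₀.ne'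
  have hx : ∀ j, (N : ℂ) * latticePoint N α j = j + α := fun j => by
    exact_mod_cast congrArg (fun x : ℝ => (x : ℂ)) (mul_latticePoint hN α j)
  rw [div_eq_iff hc]
  push_cast
  linear_combination (-((latticePoint N α k : ℂ) - latticePoint N α j) * q) *
    planck_mul_complex hN hħ + 2 * Real.pi * ħ * q * (hx k - hx j)

/-- The `(j, k)` term of the double series for the weighted product `conj φ₁ * φ₂` at
`z = (x + i q) / √2`, where `w = (x, q)`, up to the normalization of the kernels. -/
noncomputable def pairTerm (ħ : ℝ) (N : ℕ) (α : ℝ) (c₁ c₂ : ℤ → ℂ) (p : ℤ × ℤ) (w : ℝ × ℝ) : ℂ :=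
  (conj (c₁ p.1) * c₂ p.2) *
    (((positionGaussian ħ (latticePoint N α p.1) w.1 *
        positionGaussian ħ (latticePoint N α p.2) w.1 : ℝ) : ℂ) *
      Complex.exp (2 * Real.pi * (p.2 - p.1 : ℤ) * w.2 * Complex.I))

theorem continuous_pairTerm (ħ : ℝ) (N : ℕ) (α : ℝ) (c₁ c₂ : ℤ → ℂ) (p : ℤ × ℤ) :
    Continuous (pairTerm ħ N α c₁ c₂ p) := by
  unfold pairTerm positionGaussian
  fun_prop

theorem norm_pairTerm_le (hħ₀ : 0 < ħ) (α : ℝ) {c₁ c₂ : ℤ → ℂ} {M₁ M₂ : ℝ}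
    (hM₁ : ∀ j, ‖c₁ j‖ ≤ M₁) (hM₂ : ∀ j, ‖c₂ j‖ ≤ M₂) (p : ℤ × ℤ) {w : ℝ × ℝ}
    (hw : w.1 ∈ Set.Icc (0 : ℝ) 1) :
    ‖pairTerm ħ N α c₁ c₂ p w‖ ≤
      (M₁ * (Real.exp (1 / (2 * ħ)) *
        Real.exp (-(1 / (4 * ħ) * (0 - latticePoint N α p.1) ^ 2)))) *
      (M₂ * (Real.exp (1 / (2 * ħ)) *
        Real.exp (-(1 / (4 * ħ) * (0 - latticePoint N α p.2) ^ 2)))) := by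
  have hM₁0 : 0 ≤ M₁ := (norm_nonneg _).trans (hM₁ 0)
  have hM₂0 : 0 ≤ M₂ := (norm_nonneg _).trans (hM₂ 0)
  have hgg : 0 ≤ positionGaussian ħ (latticePoint N α p.1) w.1 *
      positionGaussian ħ (latticePoint N α p.2) w.1 :=
    mul_nonneg (positionGaussian_nonneg _ _ _) (positionGaussian_nonneg _ _ _)
  rw [pairTerm, norm_mul, norm_mul, norm_mul, RCLike.norm_conj, Complex.norm_real,
    show (2 * Real.pi * (p.2 - p.1 : ℤ) * w.2 * Complex.I : ℂ) =
      ((2 * Real.pi * (p.2 - p.1 : ℤ) * w.2 : ℝ) : ℂ) * Complex.I by push_cast; ring,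
    Complex.norm_exp_ofReal_mul_I, mul_one, Real.norm_of_nonneg hgg, mul_mul_mul_comm M₁]
  exact mul_le_mul (mul_le_mul (hM₁ _) (hM₂ _) (norm_nonneg _) hM₁0)
    (mul_le_mul (positionGaussian_le hħ₀ _ hw) (positionGaussian_le hħ₀ _ hw)
      (positionGaussian_nonneg _ _ _) (by positivity)) hgg (mul_nonneg hM₁0 hM₂0)

/-- The momentum integral of a term of the double series vanishes off the diagonal. -/
theorem setIntegral_pairTerm (ħ : ℝ) (N : ℕ) (α : ℝ) (c₁ c₂ : ℤ → ℂ) (p : ℤ × ℤ) :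
    ∫ w in Set.Icc (0 : ℝ) 1 ×ˢ Set.Icc (-1 : ℝ) 0, pairTerm ħ N α c₁ c₂ p w =
      if p.2 - p.1 = 0 then conj (c₁ p.1) * c₂ p.2 *
        ((∫ x in (0 : ℝ)..1, positionGaussian ħ (latticePoint N α p.1) x *
          positionGaussian ħ (latticePoint N α p.2) x : ℝ) : ℂ) else 0 := by
  simp only [pairTerm]
  rw [integral_const_mul, Measure.volume_eq_prod,
    setIntegral_prod_mul (fun x : ℝ => ((positionGaussian ħ (latticePoint N α p.1) x *
        positionGaussian ħ (latticePoint N α p.2) x : ℝ) : ℂ))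
      (fun q : ℝ => Complex.exp (2 * Real.pi * (p.2 - p.1 : ℤ) * q * Complex.I)),
    setIntegral_exp_int, integral_Icc_eq_integral_Ioc,
    ← intervalIntegral.integral_of_le zero_le_one, intervalIntegral.integral_ofReal]
  split_ifs
  · rw [mul_one]
  · rw [mul_zero, mul_zero]

/-- Termwise integration of the double series leaves a simple sum over the lattice. -/
theorem hasSum_setIntegral_tsum_pairTerm (hN : 1 ≤ N) (hħ₀ : 0 < ħ) (α : ℝ) {c₁ c₂ : ℤ → ℂ}
    {M₁ M₂ : ℝ} (hM₁ : ∀ j, ‖c₁ j‖ ≤ M₁) (hM₂ : ∀ j, ‖c₂ j‖ ≤ M₂) :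
    HasSum (fun j => conj (c₁ j) * c₂ j *
        ((∫ x in (0 : ℝ)..1, positionGaussian ħ (latticePoint N α j) x ^ 2 : ℝ) : ℂ))
      (∫ w in Set.Icc (0 : ℝ) 1 ×ˢ Set.Icc (-1 : ℝ) 0, ∑' p, pairTerm ħ N α c₁ c₂ p w) := by
  have hM₁0 : 0 ≤ M₁ := (norm_nonneg _).trans (hM₁ 0)
  have hM₂0 : 0 ≤ M₂ := (norm_nonneg _).trans (hM₂ 0)
  have hcomp : IsCompact (Set.Icc (0 : ℝ) 1 ×ˢ Set.Icc (-1 : ℝ) 0) :=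
    isCompact_Icc.prod isCompact_Icc
  have hG : Summable fun j => Real.exp (1 / (2 * ħ)) *
      Real.exp (-(1 / (4 * ħ) * (0 - latticePoint N α j) ^ 2)) :=
    (summable_gaussian_latticePoint hN α 0 (a := 1 / (4 * ħ)) (by positivity)).mul_left _
  have hGG := (hG.mul_left M₁).mul_of_nonneg (hG.mul_left M₂)
    (fun j => by positivity) (fun j => by positivity)
  have hvol : (volume : Measure (ℝ × ℝ)).real (Set.Icc (0 : ℝ) 1 ×ˢ Set.Icc (-1 : ℝ) 0) = 1 := by
    rw [measureReal_def, Measure.volume_eq_prod, Measure.prod_prod, Real.volume_Icc,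
      Real.volume_Icc]
    simp
  have hsum : Summable fun p => ∫ w in Set.Icc (0 : ℝ) 1 ×ˢ Set.Icc (-1 : ℝ) 0,
      ‖pairTerm ħ N α c₁ c₂ p w‖ := by
    refine Summable.of_nonneg_of_le (fun p => integral_nonneg fun _ => norm_nonneg _)
      (fun p => ?_) hGG
    have h := norm_setIntegral_le_of_norm_le_const (f := fun w => ‖pairTerm ħ N α c₁ c₂ p w‖)
      (μ := volume) hcomp.measure_lt_top
      (fun w hw => by rw [norm_norm]; exact norm_pairTerm_le hħ₀ α hM₁ hM₂ p hw.1)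
    rw [hvol, mul_one] at h
    exact (Real.le_norm_self _).trans h
  have hmain := hasSum_integral_of_summable_integral_norm
    (fun p => (continuous_pairTerm ħ N α c₁ c₂ p).continuousOn.integrableOn_compact hcomp) hsum
  have hdiag : Function.Injective fun j : ℤ => (j, j) := fun i j h => (Prod.ext_iff.1 h).1
  rw [← hdiag.hasSum_iff] at hmain
  · refine hmain.congr_fun fun j => ?_
    simp only [Function.comp_apply, setIntegral_pairTerm, sub_self, if_true, pow_two]
  · intro p hp
    rw [setIntegral_pairTerm, if_neg]
    exact fun h => hp ⟨p.1, Prod.ext rfl (sub_eq_zero.1 h).symm⟩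

/-- The double series for `conj φ₁ * φ₂` weighted by the Gaussian of the Bargmann measure. -/
theorem PositionWave.Represents.weighted_mul_eq_tsum (hN : 1 ≤ N)
    (hħ : 2 * Real.pi * ħ = 1 / (N : ℝ))
    (hφ₁ : φ₁ ∈ fiber ħ N θ) (hΨ₁ : Ψ₁.Represents ħ φ₁)
    (hφ₂ : φ₂ ∈ fiber ħ N θ) (hΨ₂ : Ψ₂.Represents ħ φ₂) (w : ℝ × ℝ) {z : ℂ}
    (hz : z = (Real.sqrt 2 / 2 : ℝ) • ((w.1 : ℂ) + w.2 * Complex.I)) :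
    (Real.exp (-‖z‖ ^ 2 / ħ) : ℂ) * (conj (φ₁ z) * φ₂ z) =
      (((Real.pi * ħ) ^ (-(1 / 2 : ℝ)) : ℝ) : ℂ) *
        ∑' p, pairTerm ħ N θ.1 (combCoeff Ψ₁ N θ.1) (combCoeff Ψ₂ N θ.1) p w := by
  set f₁ : ℤ → ℂ := fun j => combCoeff Ψ₁ N θ.1 j * bargmannKernel ħ z (latticePoint N θ.1 j)
    with hf₁
  set f₂ : ℤ → ℂ := fun j => combCoeff Ψ₂ N θ.1 j * bargmannKernel ħ z (latticePoint N θ.1 j)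
    with hf₂
  have hs₁ : Summable fun j => ‖conj (f₁ j)‖ := by
    simpa only [RCLike.norm_conj] using hΨ₁.summable_norm hN hħ hφ₁ z
  have hs₂ : Summable fun j => ‖f₂ j‖ := hΨ₂.summable_norm hN hħ hφ₂ z
  have h₁ : conj (φ₁ z) = ∑' j, conj (f₁ j) := by
    rw [← (hΨ₁.hasSum hN hħ hφ₁ z).tsum_eq, Complex.conj_tsum]
  have h₂ : φ₂ z = ∑' j, f₂ j := (hΨ₂.hasSum hN hħ hφ₂ z).tsum_eq.symm
  have hterm : ∀ p : ℤ × ℤ, (Real.exp (-‖z‖ ^ 2 / ħ) : ℂ) * (conj (f₁ p.1) * f₂ p.2) =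
      (((Real.pi * ħ) ^ (-(1 / 2 : ℝ)) : ℝ) : ℂ) *
        pairTerm ħ N θ.1 (combCoeff Ψ₁ N θ.1) (combCoeff Ψ₂ N θ.1) p w := by
    intro p
    have hk := conj_bargmannKernel_mul (planck_pos hN hħ) (latticePoint N θ.1 p.1)
      (latticePoint N θ.1 p.2) w.1 w.2
    rw [← hz, latticePoint_sub_mul_div hN hħ] at hk
    simp only [pairTerm, hf₁, hf₂, map_mul]
    linear_combination (conj (combCoeff Ψ₁ N θ.1 p.1) * combCoeff Ψ₂ N θ.1 p.2) * hk
  rw [h₁, h₂, tsum_mul_tsum_of_summable_norm hs₁ hs₂, ← tsum_mul_left, ← tsum_mul_left]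
  exact tsum_congr hterm

/-- Unfolding the integral over `x`: the coefficients are periodic, so the Gaussians centred at the
integer translates of a lattice point combine to a Gaussian integral over the whole line. -/
theorem tsum_mul_integral_positionGaussian (hN : 1 ≤ N) (hħ₀ : 0 < ħ) (α : ℝ) {a : ℤ → ℂ}
    (ha : Function.Periodic a (N : ℤ))
    (hs : Summable fun j => a j *
      ((∫ x in (0 : ℝ)..1, positionGaussian ħ (latticePoint N α j) x ^ 2 : ℝ) : ℂ)) (m : ℤ) :
    ∑' j, a j * ((∫ x in (0 : ℝ)..1, positionGaussian ħ (latticePoint N α j) x ^ 2 : ℝ) : ℂ) =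
      Real.sqrt (Real.pi * ħ) * ∑ j ∈ Finset.Ico m (m + N), a j := by
  rw [tsum_int_eq_sum_Ico hN hs m, Finset.mul_sum]
  refine Finset.sum_congr rfl fun r _ => ?_
  have hsq : ∀ b x : ℝ, positionGaussian ħ b x ^ 2 = Real.exp (-(1 / ħ) * (x - b) ^ 2) := by
    intro b x
    rw [positionGaussian, ← Real.exp_nat_mul]
    congr 1
    push_cast
    field_simp
  have hint : Integrable fun x : ℝ => Real.exp (-(1 / ħ) * (x - latticePoint N α r) ^ 2) :=
    (integrable_exp_neg_mul_sq (by positivity : 0 < 1 / ħ)).comp_sub_right _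
  have h := hint.hasSum_intervalIntegral_comp_add_int
  rw [integral_sub_right_eq_self (fun x : ℝ => Real.exp (-(1 / ħ) * x ^ 2)), integral_gaussian,
    div_div_eq_mul_div, div_one, ← (Equiv.neg ℤ).hasSum_iff] at h
  have h' : HasSum (fun n : ℤ => ∫ x in (0 : ℝ)..1,
      positionGaussian ħ (latticePoint N α (r + n * N)) x ^ 2) (Real.sqrt (Real.pi * ħ)) := by
    refine h.congr_fun fun n => intervalIntegral.integral_congr fun x _ => ?_
    simp only [hsq, latticePoint_add_mul hN, Equiv.neg_apply]
    congr 2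
    push_cast
    ring
  have h'' := (Complex.hasSum_ofReal.2 h').mul_left (a r)
  rw [mul_comm, ← h''.tsum_eq]
  refine tsum_congr fun n => ?_
  rw [← smul_eq_mul n (N : ℤ), ha.zsmul n r]

/-- The inner product of a fiber in terms of the coefficients, summed over any full period. -/
theorem PositionWave.Represents.fiberInner_eq (hN : 1 ≤ N) (hħ : 2 * Real.pi * ħ = 1 / (N : ℝ))
    (hφ₁ : φ₁ ∈ fiber ħ N θ) (hΨ₁ : Ψ₁.Represents ħ φ₁)
    (hφ₂ : φ₂ ∈ fiber ħ N θ) (hΨ₂ : Ψ₂.Represents ħ φ₂) (m : ℤ) :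
    fiberInner ħ φ₁ φ₂ = N * ∑ j ∈ Finset.Ico m (m + N),
      conj (combCoeff Ψ₁ N θ.1 j) * combCoeff Ψ₂ N θ.1 j := by
  have hħ₀ := planck_pos hN hħ
  obtain ⟨M₁, -, hM₁⟩ := hΨ₁.exists_norm_combCoeff_le hN hħ hφ₁
  obtain ⟨M₂, -, hM₂⟩ := hΨ₂.exists_norm_combCoeff_le hN hħ hφ₂
  have hs := hasSum_setIntegral_tsum_pairTerm hN hħ₀ θ.1 hM₁ hM₂
  have hD := setIntegral_fundamentalDomain
    (fun z => (Real.exp (-‖z‖ ^ 2 / ħ) : ℂ) * (conj (φ₁ z) * φ₂ z))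
  simp only [fun w : ℝ × ℝ => hΨ₁.weighted_mul_eq_tsum hN hħ hφ₁ hφ₂ hΨ₂ w rfl] at hD
  rw [integral_const_mul, ← hs.tsum_eq, tsum_mul_integral_positionGaussian hN hħ₀ θ.1
    (hΨ₁.conj_mul_combCoeff_periodic hN hħ hφ₁ hφ₂ hΨ₂) hs.summable m,
    Complex.real_smul] at hD
  rw [fiberInner_eq_setIntegral hħ₀, hD]
  have hconst : (Real.pi * ħ)⁻¹ * ((1 / 2) * (Real.pi * ħ) ^ (-(1 / 2 : ℝ)) *
      Real.sqrt (Real.pi * ħ)) = N := by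
    rw [Real.sqrt_eq_rpow, mul_assoc, ← Real.rpow_add (by positivity)]
    norm_num
    have := planck_mul hN hħ
    field_simp
    linarith
  rw [← mul_assoc, ← mul_assoc, ← mul_assoc]
  congr 1
  rw [← Complex.ofReal_natCast, ← hconst]
  push_cast
  ring

theorem integrableOn_fundamentalDomain (ħ : ℝ) {f : ℂ → ℂ} (hf : Continuous f) :
    IntegrableOn f fundamentalDomain (bargmannMeasure ħ) := by
  have : IsLocallyFiniteMeasure (bargmannMeasure ħ) :=
    IsLocallyFiniteMeasure.withDensity_ofReal (by fun_prop)
  refine hf.continuousOn.integrableOn_compact ?_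
  refine Metric.isCompact_of_isClosed_isBounded ?_ ?_
  · have : fundamentalDomain = (fun z : ℂ => Real.sqrt 2 * z.re) ⁻¹' Set.Icc 0 1 ∩
        (fun z : ℂ => -(Real.sqrt 2 * z.im)) ⁻¹' Set.Icc 0 1 := rfl
    rw [this]
    exact (isClosed_Icc.preimage (by fun_prop)).inter (isClosed_Icc.preimage (by fun_prop))
  · refine isBounded_iff_forall_norm_le.2 ⟨2, fun z hz => ?_⟩
    obtain ⟨⟨h1, h2⟩, h3, h4⟩ := hz
    have hs : 1 ≤ Real.sqrt 2 := Real.one_le_sqrt.2 one_le_two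
    have hre : |z.re| ≤ 1 := abs_le.2 ⟨by nlinarith, by nlinarith⟩
    have him : |z.im| ≤ 1 := abs_le.2 ⟨by nlinarith, by nlinarith⟩
    exact (Complex.norm_le_abs_re_add_abs_im z).trans (by linarith)

end

end QuantumTorus

theorem mainTheorem6 (N : ℕ) (hN : 1 ≤ N) (ħ : ℝ) (hħ : 2 * Real.pi * ħ = 1 / (N : ℝ))
    (θ : ℝ × ℝ) :
    (∀ φ ∈ QuantumTorus.fiber ħ N θ,
      ∃ Ψ : QuantumTorus.PositionWave, Ψ.Represents ħ φ) ∧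
    (∀ φ₁ ∈ QuantumTorus.fiber ħ N θ, ∀ φ₂ ∈ QuantumTorus.fiber ħ N θ,
      ∀ Ψ₁ Ψ₂ : QuantumTorus.PositionWave, Ψ₁.Represents ħ φ₁ → Ψ₂.Represents ħ φ₂ →
        MeasureTheory.IntegrableOn (fun z : ℂ => conj (φ₁ z) * φ₂ z)
          QuantumTorus.fundamentalDomain (QuantumTorus.bargmannMeasure ħ) ∧
        (∀ x : ℝ, MeasureTheory.Integrable
          (fun y : ℝ => QuantumTorus.kernelK ħ x y * Ψ₂.phase y) Ψ₂.mass) ∧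
        MeasureTheory.IntegrableOn
          (fun x : ℝ => conj (Ψ₁.phase x) * QuantumTorus.applyK ħ Ψ₂ x)
          (Set.Ico (0 : ℝ) 1) Ψ₁.mass ∧
        QuantumTorus.fiberInner ħ φ₁ φ₂ =
          QuantumTorus.unitPairing Ψ₁ (QuantumTorus.applyK ħ Ψ₂)) := by
  refine ⟨fun φ hφ => QuantumTorus.exists_represents hN hħ hφ,
    fun φ₁ hφ₁ φ₂ hφ₂ Ψ₁ Ψ₂ hΨ₁ hΨ₂ => ?_⟩
  have hd₁ := ((QuantumTorus.mem_fiber_iff hN hħ).1 hφ₁).1.continuous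
  have hd₂ := ((QuantumTorus.mem_fiber_iff hN hħ).1 hφ₂).1.continuous
  obtain ⟨hint, hpair⟩ := hΨ₁.unitPairing_eq hN hħ hφ₁ hφ₂ hΨ₂
  exact ⟨QuantumTorus.integrableOn_fundamentalDomain ħ
      ((Complex.continuous_conj.comp hd₁).mul hd₂),
    hΨ₂.integrable_kernelK hN hħ hφ₂, hint,
    (hΨ₁.fiberInner_eq hN hħ hφ₁ hφ₂ hΨ₂ _).trans hpair.symm⟩
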